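/- Lemma (Optimality of the scaling). Let $d\ge 1$ and $0<\beta\le 2$. Then there exists a scalar, centered, stationary Gaussian random field $\omega=\{\omega(x)\}_{x\in\mathbb{R}^d}$ with continuous realizations whose covariance function $c(x):=\mathbb{E}[\omega(x)\omega(0)]$ satisfies $$|c(x)|\le |x|^{-\beta}\qquad\text{for all } |x|\ge 1,$$ and for which the following holds. Call a random field $\phi$ on $\mathbb{R}^d$ a linearized corrector if, almost surely, $\phi$ is continuous, solves $$-\Delta\phi=\nabla\cdot(\omega e_1)\qquad\text{in the sense of distributions on }\mathbb{R}^d,$$ and has sublinear growth in the sense that $$\lim_{R\uparrow\infty}\frac{1}{|B_R|}\int_{B_R}\frac{|\phi(x)|^2}{R^2}\,dx=0,$$ where $B_R$ is the ball of radius $R$ centered at the origin. Then a linearized corrector exists, and there are constants $C>0$ and $R_0\ge 1$ such that every linearized corrector $\phi$ satisfies, for all $R\ge R_0$, $$\frac{1}{|\{R<|x|<2R\}|}\int_{R<|x|<2R}\mathbb{E}\big[|\phi(x)-\phi(0)|^2\big]\,dx\;\ge\; C\cdot\begin{cases}R^{2-\beta}&\text{if }\beta<2,\\ \log^2R&\text{if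 }\beta=2=d,\\ \log R&\text{if }\beta=2<d.\end{cases}$$ (In the case $\beta=2$, $d=1$ no lower bound is claimed.) -/

import Mathlib

open MeasureTheory ProbabilityTheory Filter Topology


/-- Euclidean space `ℝ^d`. -/
abbrev Eucl (d : ℕ) : Type := EuclideanSpace ℝ (Fin d)

/-- A scalar, centered, stationary Gaussian random field on `ℝ^d` with continuous realizations.
Stationarity: for every shift `z`, the shifted field has the same law on `ℝ^d → ℝ`. -/
structure IsCenteredStationaryGaussianField {d : ℕ} {Ω : Type*} [MeasurableSpace Ω]
    (P : Measure Ω) (w : Ω → Eucl d → ℝ) : Prop where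
  measurable : ∀ x, Measurable (fun s => w s x)
  continuous : ∀ s, Continuous (w s)
  gaussian : IsGaussianProcess (fun x s => w s x) P
  centered : ∀ x, ∫ s, w s x ∂P = 0
  stationary : ∀ z : Eucl d, IdentDistrib (fun s x => w s (x + z)) w P P

/-- The covariance function `c(x) = Cov(w(x), w(0))` of a random field. -/
noncomputable def covFun {d : ℕ} {Ω : Type*} [MeasurableSpace Ω]
    (P : Measure Ω) (w : Ω → Eucl d → ℝ) (x : Eucl d) : ℝ :=
  covariance (fun s => w s x) (fun s => w s 0) P

/-- `u` solves `-Δ u = ∇ · (w e)` on `ℝ^d` in the sense of distributions. Two integrations by parts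
against a test function `ζ` turn the equation into `∫ u Δζ = ∫ w (e · ∇ζ)`. -/
def SolvesLinearizedEq {d : ℕ} (e : Eucl d) (w u : Eucl d → ℝ) : Prop :=
  ∀ ζ : Eucl d → ℝ, ContDiff ℝ (⊤ : ℕ∞) ζ → HasCompactSupport ζ →
    ∫ y, u y * Laplacian.laplacian ζ y = ∫ y, w y * fderiv ℝ ζ y e

/-- Sublinear growth: the average of `|u|² / R²` over the ball `B_R` tends to `0` as `R → ∞`. -/
def SublinearGrowth {d : ℕ} (u : Eucl d → ℝ) : Prop :=
  Tendsto (fun R : ℝ => ⨍ x in Metric.ball (0 : Eucl d) R, |u x| ^ 2 / R ^ 2) atTop (𝓝 0)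

/-- `φ` is a random field which, for almost every realization, is a (continuous representative of
a) solution with sublinear growth of `-Δφ = ∇ · (w e)`. -/
structure IsLinearizedCorrector {d : ℕ} {Ω : Type*} [MeasurableSpace Ω]
    (P : Measure Ω) (e : Eucl d) (w φ : Ω → Eucl d → ℝ) : Prop where
  aemeasurable : ∀ x, AEMeasurable (fun s => φ s x) P
  continuous : ∀ᵐ s ∂P, Continuous (φ s)
  solves : ∀ᵐ s ∂P, SolvesLinearizedEq e (w s) (φ s)
  sublinear : ∀ᵐ s ∂P, SublinearGrowth (φ s)

/-- The average over the annulus `R < |x| < 2R` of the expectation `E|φ(x) - φ(0)|²`, as a Lebesgue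
integral with values in `[0, ∞]`. -/
noncomputable def annularMeanSquare {d : ℕ} {Ω : Type*} [MeasurableSpace Ω]
    (P : Measure Ω) (φ : Ω → Eucl d → ℝ) (R : ℝ) : ENNReal :=
  ⨍⁻ x, (∫⁻ s, ENNReal.ofReal (|φ s x - φ s 0| ^ 2) ∂P)
    ∂(volume.restrict {x : Eucl d | R < ‖x‖ ∧ ‖x‖ < 2 * R})

/-!
# Optimality of the scaling for linearized correctors

In Fourier variables the equation `-Δφ = ∇ · (ω e)` reads `φ̂(k) = i (e · k) / |k|² ω̂(k)`. So
if `ω` is Gaussian with spectral measure `μ`, then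
`E |φ(x) - φ(0)|² = ∫ ((e · k) / |k|²)² 2 (1 - cos (k · x)) μ(dk)` (`incrementDensity`), and the
task is to choose `μ` so that the covariance `∫ cos (k · x) μ(dk)` is at most `|x|^{-β}` while
this integral has the claimed growth.

**The spectral measure.** `multiscaleMeasure` is `∑ₙ κ bⁿ γₙ` with `b = 2^{-β}` and `γₙ` the
image of the Gaussian weight `e^{-2|p|²} dp` under `p ↦ 2^{-n} p`. The covariance is a geometric
mixture of Gaussians of widths `2ⁿ`, hence at most a multiple of `|x|^{-β}`
(`tsum_pow_mul_exp_neg_le`). By scaling, the `n`-th component contributes `(4b)ⁿ` times the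
second moment for `γ₀` over the distance `2^{-n}|x|`. That moment is bounded below by replacing
`(e · k)²` by `2 (1 - cos (e · k))` and `|k|⁻⁴` by a dyadic sum of Gaussians, which leaves
explicit Gaussian integrals (`sum_le_lintegral_incrementDensity_gaussianWeight`): the
frequencies of order `2^{-m}` contribute `(4 / 2^d)^m`. With `2^N ≤ |x| < 2^{N+1}`, the sum over
`n + m ≤ N` of `(4b)ⁿ (4 / 2^d)^m` is at least of order `|x|^{2-β}` always, of order `log |x|`
if `4b = 1`, and of order `log² |x|` if moreover `4 = 2^d`.

**Realization of the field and the corrector.** Both are images under an isonormal process of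
the real waves `planeWave x` and `correctorWave e x` in `L²(μ)`. To obtain continuous
realizations without a continuity criterion for random fields, the waves are expanded in Taylor
series in `x`, indexed by words in the coordinates: they are series `∑ⱼ (fockVector x)ⱼ cⱼ(k)`,
where `fockVector x` is a vector of `ℓ²` depending continuously on `x`, and
`∑ⱼ cⱼ(k)² ≤ e^{|k|²}`. The exponential moment `∫ e^{|k|²} dμ < ∞` makes the `cⱼ` square summable in `L²(μ)`,
so their Gaussian images form a random element of `ℓ²`, and pairing it with `fockVector x` gives
a field with continuous realizations. The equation for a fixed test function is a linear
relation between the two random elements of `ℓ²`, and by separability all these relations hold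
simultaneously almost surely (`exists_gaussianField_of_spectralMeasure`). The bound
`E |φ(x)|² ≲ |x|^{2-ε}` for some `ε > 0` gives sublinear growth almost surely
(`ae_sublinearGrowth_of_lintegral_sq_le`).

**Uniqueness.** The difference of two correctors is weakly harmonic with sublinear growth, so it
is constant by a Liouville theorem (`eq_of_weakly_harmonic_of_sublinearGrowth`). Therefore every
corrector has the increments of the one constructed here, and the lower bound holds for all of
them.
-/

/-! ### A Liouville theorem for weakly harmonic functions -/

/-- A radial kernel `η` whose moment field `z ↦ η z • z` is the gradient of a compactly supported
function `Ψ`. The generator `d • η + z · ∇η` of the dilations of `η` is then the Laplacian of `Ψ`,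
which is why averages of a weakly harmonic function against dilates of `η` do not depend on the
scale. -/
theorem exists_radial_kernel {d : ℕ} (hd : 0 < d) :
    ∃ Ψ η : Eucl d → ℝ, ContDiff ℝ (⊤ : ℕ∞) Ψ ∧ ContDiff ℝ (⊤ : ℕ∞) η ∧
      HasCompactSupport Ψ ∧ (∀ z, 2 < ‖z‖ → η z = 0) ∧ 0 < ∫ z, η z ∧
      ∀ z, HasFDerivAt Ψ (η z • innerSL ℝ z) z := by
  let ψ : ℝ → ℝ := fun t => -Real.smoothTransition (2 - t)
  have hψ : ContDiff ℝ (⊤ : ℕ∞) ψ :=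
    (Real.smoothTransition.contDiff.comp (contDiff_const.sub contDiff_id)).neg
  have hψ' : ContDiff ℝ (⊤ : ℕ∞) (deriv ψ) :=
    ((contDiff_infty_iff_deriv (𝕜 := ℝ)).1 hψ).2
  have hdiff : Differentiable ℝ ψ := hψ.differentiable (by simp)
  have hmono : Monotone ψ := fun a b hab =>
    neg_le_neg (Real.smoothTransition.monotone (by linarith))
  have hnonneg : ∀ t, 0 ≤ deriv ψ t := fun t => hmono.deriv_nonneg
  have hzero : ∀ t, 2 ≤ t → ψ t = 0 := fun t ht => by
    simp only [ψ, Real.smoothTransition.zero_of_nonpos (by linarith : 2 - t ≤ 0), neg_zero]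
  have hzero' : ∀ t, 2 < t → deriv ψ t = 0 := by
    intro t ht
    have : ψ =ᶠ[𝓝 t] fun _ => 0 := by
      filter_upwards [lt_mem_nhds ht] with s hs using hzero s hs.le
    rw [this.deriv_eq, deriv_const]
  have hnorm : ∀ z : Eucl d, HasFDerivAt (fun z : Eucl d => ‖z‖ ^ 2) (2 • innerSL ℝ z) z :=
    fun z => (hasStrictFDerivAt_norm_sq z).hasFDerivAt
  have hsq : ∀ z : Eucl d, 2 < ‖z‖ → 2 < ‖z‖ ^ 2 := fun z hz => by nlinarith
  have hηc : ContDiff ℝ (⊤ : ℕ∞) (fun z : Eucl d => 2 * deriv ψ (‖z‖ ^ 2)) :=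
    contDiff_const.mul (hψ'.comp (contDiff_norm_sq ℝ))
  have hηs : ∀ z : Eucl d, 2 < ‖z‖ → 2 * deriv ψ (‖z‖ ^ 2) = 0 := fun z hz => by
    rw [hzero' _ (hsq z hz), mul_zero]
  refine ⟨fun z => ψ (‖z‖ ^ 2), fun z => 2 * deriv ψ (‖z‖ ^ 2), hψ.comp (contDiff_norm_sq ℝ),
    hηc, ?_, hηs, ?_, fun z => ?_⟩
  · refine HasCompactSupport.intro (isCompact_closedBall 0 2) fun z hz => ?_
    rw [mem_closedBall_zero_iff, not_le] at hz
    exact hzero _ (hsq z hz).le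
  · -- the derivative of `ψ` cannot vanish on `[1, 2]`, as `ψ` increases from `-1` to `0` there
    obtain ⟨t, ht, htd⟩ := exists_deriv_eq_slope ψ (by norm_num : (1 : ℝ) < 2)
      hψ.continuous.continuousOn hdiff.differentiableOn
    have hpos : 0 < deriv ψ t := by
      rw [htd]
      norm_num [ψ]
    have hcs : HasCompactSupport (fun z : Eucl d => 2 * deriv ψ (‖z‖ ^ 2)) := by
      refine HasCompactSupport.intro (isCompact_closedBall 0 2) fun z hz => ?_
      rw [mem_closedBall_zero_iff, not_le] at hz
      exact hηs z hz
    refine hηc.continuous.integral_pos_of_hasCompactSupport_nonneg_nonzero hcs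
      (fun z => mul_nonneg zero_le_two (hnonneg _))
      (x := EuclideanSpace.single ⟨0, hd⟩ (√t)) ?_
    have : ‖EuclideanSpace.single (⟨0, hd⟩ : Fin d) (√t)‖ ^ 2 = t := by
      rw [PiLp.norm_single, Real.norm_eq_abs, sq_abs, Real.sq_sqrt (by linarith [ht.1])]
    rw [this]
    positivity
  · have h := (hdiff (‖z‖ ^ 2)).hasDerivAt.comp_hasFDerivAt z (hnorm z)
    refine h.congr_fderiv ?_
    ext v
    simp
    ring

theorem laplacian_comp_smul_sub {d : ℕ} {Ψ η : Eucl d → ℝ} (hη : ContDiff ℝ (⊤ : ℕ∞) η)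
    (hΨ : ∀ z, HasFDerivAt Ψ (η z • innerSL ℝ z) z) (s : ℝ) (x y : Eucl d) :
    Laplacian.laplacian (fun y => Ψ (s • (y - x))) y =
      s ^ 2 * (d * η (s • (y - x)) + fderiv ℝ η (s • (y - x)) (s • (y - x))) := by
  have hA : ∀ y, HasFDerivAt (fun y : Eucl d => s • (y - x)) (s • ContinuousLinearMap.id ℝ _) y :=
    fun y => ((hasFDerivAt_id y).sub_const x).const_smul s
  have hd1 : fderiv ℝ (fun y => Ψ (s • (y - x))) =
      fun y => (s * η (s • (y - x))) • innerSL ℝ (s • (y - x)) := by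
    funext y
    refine (((hΨ _).comp y (hA y)).congr_fderiv ?_).fderiv
    ext v
    simp
    ring
  have hη' : ∀ z, HasFDerivAt η (fderiv ℝ η z) z := fun z =>
    (hη.differentiable (by simp) z).hasFDerivAt
  have hd2 : ∀ v, fderiv ℝ (fun y => (s * η (s • (y - x))) • innerSL ℝ (s • (y - x))) y v v =
      s ^ 2 * (η (s • (y - x)) * inner ℝ v v +
        inner ℝ v (s • (y - x)) * fderiv ℝ η (s • (y - x)) v) := by
    intro v
    have h : fderiv ℝ (fun y => (s * η (s • (y - x))) • innerSL ℝ (s • (y - x))) y = _ :=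
      ((((hη' _).comp y (hA y)).const_mul s).smul
        (((innerSL ℝ (E := Eucl d)).hasFDerivAt (x := s • (y - x))).comp y (hA y))).fderiv
    rw [h, real_inner_comm (s • (y - x))]
    generalize hz : s • (y - x) = z
    simp only [Function.comp_apply, hz, add_apply, smul_apply,
      ContinuousLinearMap.comp_apply, smul_eq_mul, ContinuousLinearMap.smulRight_apply,
      ContinuousLinearMap.id_apply, map_smul]
    change s * η z * (s * inner ℝ v v) + s * (s * fderiv ℝ η z v) * inner ℝ z v = _
    ring
  rw [InnerProductSpace.laplacian_eq_iteratedFDeriv_stdOrthonormalBasis]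
  simp only [iteratedFDeriv_two_apply, hd1, Matrix.cons_val_zero, Matrix.cons_val_one, hd2]
  generalize s • (y - x) = z
  have hsum : ∑ i, inner ℝ (stdOrthonormalBasis ℝ (Eucl d) i) z *
      fderiv ℝ η z (stdOrthonormalBasis ℝ (Eucl d) i) = fderiv ℝ η z z := by
    have h := congrArg (fderiv ℝ η z) ((stdOrthonormalBasis ℝ (Eucl d)).sum_repr' z)
    rw [map_sum] at h
    simpa only [map_smul, smul_eq_mul] using h
  rw [← Finset.mul_sum, Finset.sum_add_distrib, hsum]
  simp only [real_inner_self_eq_norm_sq, OrthonormalBasis.norm_eq_one, one_pow, mul_one,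
    Finset.sum_const, Finset.card_univ, Fintype.card_fin, finrank_euclideanSpace_fin, nsmul_eq_mul]

/-- Averages of a continuous weakly harmonic function against dilates of the kernel of
`exists_radial_kernel` do not depend on the scale. -/
theorem integral_mul_radial_kernel_eq {d : ℕ} {Ψ η : Eucl d → ℝ}
    (hΨc : ContDiff ℝ (⊤ : ℕ∞) Ψ) (hη : ContDiff ℝ (⊤ : ℕ∞) η) (hΨs : HasCompactSupport Ψ)
    (hηs : ∀ z, 2 < ‖z‖ → η z = 0) (hΨ : ∀ z, HasFDerivAt Ψ (η z • innerSL ℝ z) z)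
    {u : Eucl d → ℝ} (hu : Continuous u)
    (hharm : ∀ ζ : Eucl d → ℝ, ContDiff ℝ (⊤ : ℕ∞) ζ → HasCompactSupport ζ →
      ∫ y, u y * Laplacian.laplacian ζ y = 0)
    (x : Eucl d) {s t : ℝ} (hs : 0 < s) (ht : 0 < t) :
    ∫ y, u y * (s ^ d * η (s • (y - x))) = ∫ y, u y * (t ^ d * η (t • (y - x))) := by
  have hηd : Differentiable ℝ η := hη.differentiable (by simp)
  have hηf : Continuous (fderiv ℝ η) := hη.continuous_fderiv (by simp)
  -- the derivative in `s` of the dilated kernel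
  let F' : ℝ → Eucl d → ℝ := fun s y =>
    u y * (d * s ^ (d - 1) * η (s • (y - x)) + s ^ d * fderiv ℝ η (s • (y - x)) (y - x))
  have hF' : ∀ s y, HasDerivAt (fun s : ℝ => u y * (s ^ d * η (s • (y - x)))) (F' s y) s := by
    intro s y
    have h1 : HasDerivAt (fun s : ℝ => s • (y - x)) (y - x) s := by
      simpa using (hasDerivAt_id s).smul_const (y - x)
    have h2 := (hηd (s • (y - x))).hasFDerivAt.comp_hasDerivAt s h1
    exact ((hasDerivAt_pow d s).mul h2).const_mul (u y)
  have hF'c : Continuous (Function.uncurry F') := by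
    simp only [F', Function.uncurry_def]
    fun_prop
  have hzero : ∀ s y, s * ‖y - x‖ ≤ 2 ∨ s < 0 ∨ F' s y = 0 := by
    intro s y
    by_cases h0 : s < 0
    · exact Or.inr (Or.inl h0)
    by_cases h1 : s * ‖y - x‖ ≤ 2
    · exact Or.inl h1
    have hz : 2 < ‖s • (y - x)‖ := by
      rw [norm_smul, Real.norm_of_nonneg (not_lt.1 h0)]
      exact not_le.1 h1
    have hev : η =ᶠ[𝓝 (s • (y - x))] fun _ => 0 := by
      filter_upwards [continuous_norm.continuousAt.eventually (lt_mem_nhds hz)] with z hz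
      exact hηs z hz
    refine Or.inr (Or.inr ?_)
    simp only [F']
    rw [hηs _ hz, hev.fderiv_eq, fderiv_fun_const]
    simp
  have hderiv : ∀ s, 0 < s →
      HasDerivAt (fun s : ℝ => ∫ y, u y * (s ^ d * η (s • (y - x)))) (∫ y, F' s y) s := by
    intro s hs
    -- on `[s / 2, 2 s]` all integrands live on a fixed ball
    let K : Set (Eucl d) := Metric.closedBall x (4 / s)
    have hK : IsCompact K := isCompact_closedBall x _
    obtain ⟨M, hM⟩ := ((isCompact_Icc (a := s / 2) (b := 2 * s)).prod hK).exists_bound_of_continuousOn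
      hF'c.continuousOn
    refine (hasDerivAt_integral_of_dominated_loc_of_deriv_le (F' := F')
      (bound := K.indicator fun _ => M)
      (Icc_mem_nhds (by linarith : s / 2 < s) (by linarith : s < 2 * s)) ?_ ?_ ?_ ?_ ?_ ?_).2
    · refine Eventually.of_forall fun r => Continuous.aestronglyMeasurable ?_
      have := hη.continuous
      fun_prop
    · refine Continuous.integrable_of_hasCompactSupport ?_ ?_
      · have := hη.continuous
        fun_prop
      · refine HasCompactSupport.intro (isCompact_closedBall x (2 / s)) fun y hy => ?_
        rw [Metric.mem_closedBall, not_le, dist_eq_norm, div_lt_iff₀ hs] at hy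
        rw [hηs, mul_zero, mul_zero]
        rw [norm_smul, Real.norm_of_nonneg hs.le]
        linarith
    · exact (hF'c.comp (Continuous.prodMk_right s)).aestronglyMeasurable
    · refine Eventually.of_forall fun y r hr => ?_
      by_cases hy : y ∈ K
      · rw [Set.indicator_of_mem hy]
        exact hM (r, y) ⟨hr, hy⟩
      · rw [Set.indicator_of_notMem hy]
        have hr0 : 0 < r := by linarith [hr.1]
        rcases hzero r y with h | h | h
        · exfalso
          apply hy
          rw [Metric.mem_closedBall, dist_eq_norm, le_div_iff₀ hs]
          nlinarith [hr.1, norm_nonneg (y - x)]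
        · linarith
        · rw [h, norm_zero]
    · exact (integrable_indicator_iff hK.measurableSet).2
        (integrableOn_const hK.measure_lt_top.ne)
    · exact Eventually.of_forall fun y r _ => hF' r y
  have hderiv0 : ∀ s, 0 < s → ∫ y, F' s y = 0 := by
    intro s hs
    have hc : ContDiff ℝ (⊤ : ℕ∞) (fun y => Ψ (s • (y - x))) :=
      hΨc.comp ((contDiff_id.sub contDiff_const).const_smul s)
    have hcs : HasCompactSupport (fun y => Ψ (s • (y - x))) := by
      have := hΨs.comp_homeomorph ((Homeomorph.subRight x).trans (Homeomorph.smulOfNeZero s hs.ne'))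
      exact this
    have h := hharm _ hc hcs
    have hrel : ∀ y, F' s y * s ^ 3 =
        s ^ d * (u y * Laplacian.laplacian (fun y => Ψ (s • (y - x))) y) := by
      intro y
      rw [laplacian_comp_smul_sub hη hΨ]
      simp only [F', map_smul, smul_eq_mul]
      rcases Nat.eq_zero_or_pos d with hd | hd
      · subst hd
        simp
        ring
      · obtain ⟨m, rfl⟩ : ∃ m, d = m + 1 := ⟨d - 1, by omega⟩
        simp only [Nat.add_sub_cancel]
        ring
    have h2 : (∫ y, F' s y) * s ^ 3 = 0 := by
      rw [← integral_mul_const]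
      simp only [hrel]
      rw [integral_const_mul, h, mul_zero]
    simpa [hs.ne'] using h2
  refine isOpen_Ioi.is_const_of_deriv_eq_zero (s := Set.Ioi (0 : ℝ)) isPreconnected_Ioi
    (fun r hr => (hderiv r hr).differentiableAt.differentiableWithinAt) (fun r hr => ?_) hs ht
  rw [(hderiv r hr).deriv, hderiv0 r hr]
  rfl

theorem mul_integral_eq_integral_mul_radial_kernel {d : ℕ} {Ψ η : Eucl d → ℝ}
    (hΨc : ContDiff ℝ (⊤ : ℕ∞) Ψ) (hη : ContDiff ℝ (⊤ : ℕ∞) η) (hΨs : HasCompactSupport Ψ)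
    (hηs : ∀ z, 2 < ‖z‖ → η z = 0) (hΨ : ∀ z, HasFDerivAt Ψ (η z • innerSL ℝ z) z)
    {u : Eucl d → ℝ} (hu : Continuous u)
    (hharm : ∀ ζ : Eucl d → ℝ, ContDiff ℝ (⊤ : ℕ∞) ζ → HasCompactSupport ζ →
      ∫ y, u y * Laplacian.laplacian ζ y = 0)
    (x : Eucl d) {s : ℝ} (hs : 0 < s) :
    u x * ∫ z, η z = ∫ y, u y * (s ^ d * η (s • (y - x))) := by
  have hηc : Continuous η := hη.continuous
  let G : ℝ → ℝ := fun r => ∫ z, u (r • z + x) * η z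
  have hGc : Continuous G := by
    have h := continuous_parametric_integral_of_continuous (μ := (volume : Measure (Eucl d)))
      (f := fun (r : ℝ) (z : Eucl d) => u (r • z + x) * η z) (by fun_prop)
      (isCompact_closedBall (0 : Eucl d) 2)
    convert h using 2 with r
    refine (setIntegral_eq_integral_of_forall_compl_eq_zero fun z hz => ?_).symm
    rw [mem_closedBall_zero_iff, not_le] at hz
    rw [hηs z hz, mul_zero]
  have hG : ∀ t : ℝ, 0 < t → G t⁻¹ = ∫ y, u y * (t ^ d * η (t • (y - x))) := by
    intro t ht
    rw [← integral_add_right_eq_self _ x]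
    simp only [add_sub_cancel_right]
    have h := Measure.integral_comp_smul_of_nonneg (volume : Measure (Eucl d))
      (fun z => u (t⁻¹ • z + x) * (t ^ d * η z)) t (hR := ht.le)
    simp only [smul_smul, inv_mul_cancel₀ ht.ne', one_smul, finrank_euclideanSpace_fin,
      smul_eq_mul] at h
    rw [h, ← integral_const_mul]
    refine integral_congr_ae (Eventually.of_forall fun z => ?_)
    field_simp
  have h0 : G 0 = u x * ∫ z, η z := by
    simp only [G, zero_smul, zero_add, integral_const_mul]
  have hlim : Tendsto (fun t : ℝ => G t⁻¹) atTop (𝓝 (G 0)) :=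
    (hGc.tendsto 0).comp tendsto_inv_atTop_zero
  rw [← h0]
  refine tendsto_nhds_unique hlim (tendsto_const_nhds.congr' ?_)
  filter_upwards [eventually_gt_atTop 0] with t ht
  rw [hG t ht]
  exact integral_mul_radial_kernel_eq hΨc hη hΨs hηs hΨ hu hharm x hs ht

/-- **Liouville theorem**: a continuous weakly harmonic function of sublinear growth is constant. -/
theorem eq_of_weakly_harmonic_of_sublinearGrowth {d : ℕ} (hd : 0 < d) {u : Eucl d → ℝ}
    (hu : Continuous u)
    (hharm : ∀ ζ : Eucl d → ℝ, ContDiff ℝ (⊤ : ℕ∞) ζ → HasCompactSupport ζ →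
      ∫ y, u y * Laplacian.laplacian ζ y = 0)
    (hsub : SublinearGrowth u) (x : Eucl d) : u x = u 0 := by
  obtain ⟨Ψ, η, hΨc, hη, hΨs, hηs, hpos, hΨ⟩ := exists_radial_kernel hd
  have hηcs : HasCompactSupport η := by
    refine HasCompactSupport.intro (isCompact_closedBall 0 2) fun z hz => ?_
    rw [mem_closedBall_zero_iff, not_le] at hz
    exact hηs z hz
  have hηc : Continuous η := hη.continuous
  obtain ⟨L, hL⟩ := hη.lipschitzWith_of_hasCompactSupport hηcs (by simp)
  have hrep := mul_integral_eq_integral_mul_radial_kernel hΨc hη hΨs hηs hΨ hu hharm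
  set c := ∫ z, η z
  -- comparison of the two averages on the ball of radius `R`
  have hvol : ∀ R : ℝ, 0 < R → volume.real (Metric.ball (0 : Eucl d) R) =
      R ^ Module.finrank ℝ (Eucl d) * volume.real (Metric.ball (0 : Eucl d) 1) := by
    intro R hR
    rw [Measure.real, Measure.addHaar_ball_of_pos volume _ hR, ENNReal.toReal_mul,
      ENNReal.toReal_ofReal (by positivity), Measure.real]
  have hball : ∀ R : ℝ, 0 < R → ∀ f : Eucl d → ℝ,
      ⨍ y in Metric.ball (0 : Eucl d) R, f y =
        (R ^ d * volume.real (Metric.ball (0 : Eucl d) 1))⁻¹ * ∫ y in Metric.ball (0 : Eucl d) R, f y := by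
    intro R hR f
    rw [setAverage_eq, smul_eq_mul, hvol R hR,
      finrank_euclideanSpace_fin]
  have hv : 0 < volume.real (Metric.ball (0 : Eucl d) 1) :=
    ENNReal.toReal_pos (Metric.measure_ball_pos _ _ one_pos).ne' measure_ball_lt_top.ne
  set v := volume.real (Metric.ball (0 : Eucl d) 1)
  let A : ℝ := 5 ^ (d + 1) * L * ‖x‖ * v
  have hA : 0 ≤ A := by positivity
  have hion : ∀ (R : ℝ) (f : Eucl d → ℝ), Continuous f → IntegrableOn f (Metric.ball 0 R) :=
    fun R f hf => (hf.continuousOn.integrableOn_compact (isCompact_closedBall 0 R)).mono_set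
      Metric.ball_subset_closedBall
  have hbound : ∀ R : ℝ, 0 < R → 2 * ‖x‖ < R →
      |u x - u 0| * c ≤ A * ⨍ y in Metric.ball (0 : Eucl d) R, |u y| / R := by
    intro R hR hxR
    have hs : 0 < 5 / R := by positivity
    have hz : ∀ y ∉ Metric.ball (0 : Eucl d) R, η ((5 / R) • (y - x)) - η ((5 / R) • (y - 0)) = 0 := by
      intro y hy
      rw [mem_ball_zero_iff, not_lt] at hy
      rw [hηs, hηs, sub_zero]
      · rw [norm_smul, Real.norm_of_nonneg hs.le, sub_zero, div_mul_eq_mul_div, lt_div_iff₀ hR]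
        linarith
      · rw [norm_smul, Real.norm_of_nonneg hs.le, div_mul_eq_mul_div, lt_div_iff₀ hR]
        have := norm_sub_norm_le y x
        linarith
    have hi : ∀ x : Eucl d, Integrable fun y => u y * ((5 / R) ^ d * η ((5 / R) • (y - x))) := by
      intro x
      refine Continuous.integrable_of_hasCompactSupport (by fun_prop) ?_
      refine HasCompactSupport.intro (isCompact_closedBall x (2 / (5 / R))) fun y hy => ?_
      rw [Metric.mem_closedBall, not_le, dist_eq_norm, div_lt_iff₀ hs] at hy
      rw [hηs, mul_zero, mul_zero]
      rw [norm_smul, Real.norm_of_nonneg hs.le]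
      linarith
    have h1 : (u x - u 0) * c = ∫ y in Metric.ball (0 : Eucl d) R, u y * ((5 / R) ^ d *
        (η ((5 / R) • (y - x)) - η ((5 / R) • (y - 0)))) := by
      rw [sub_mul, hrep x hs, hrep 0 hs, ← integral_sub (hi x) (hi 0),
        setIntegral_eq_integral_of_forall_compl_eq_zero fun y hy => by rw [hz y hy, mul_zero, mul_zero]]
      refine integral_congr_ae (Eventually.of_forall fun y => ?_)
      ring
    have h2 : |u x - u 0| * c = |(u x - u 0) * c| := by rw [abs_mul, abs_of_pos hpos]
    rw [h2, h1, hball R hR]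
    calc |∫ y in Metric.ball (0 : Eucl d) R, u y * ((5 / R) ^ d *
        (η ((5 / R) • (y - x)) - η ((5 / R) • (y - 0))))|
        ≤ ∫ y in Metric.ball (0 : Eucl d) R, (5 / R) ^ (d + 1) * L * ‖x‖ * |u y| := by
          rw [← Real.norm_eq_abs]
          refine norm_integral_le_of_norm_le (hion R (fun y => (5 / R) ^ (d + 1) * L * ‖x‖ * |u y|)
            (by fun_prop)).integrable ?_
          refine Eventually.of_forall fun y => ?_
          have hl := hL.dist_le_mul ((5 / R) • (y - x)) ((5 / R) • (y - 0))
          rw [Real.dist_eq, dist_eq_norm, ← smul_sub, norm_smul, Real.norm_of_nonneg hs.le] at hl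
          have he : y - x - (y - 0) = -x := by abel
          rw [he, norm_neg] at hl
          rw [norm_mul, norm_mul, Real.norm_of_nonneg (by positivity : 0 ≤ (5 / R) ^ d),
            Real.norm_eq_abs, Real.norm_eq_abs]
          calc |u y| * ((5 / R) ^ d * |η ((5 / R) • (y - x)) - η ((5 / R) • (y - 0))|)
              ≤ |u y| * ((5 / R) ^ d * (L * (5 / R * ‖x‖))) := by gcongr
            _ = _ := by ring
      _ = _ := by
          rw [integral_const_mul, integral_div]
          simp only [A, div_pow]
          field_simp
          ring
  -- conclusion, using `|u| / R ≤ (ε + ε⁻¹ |u|² / R²) / 2`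
  have hlim : ∀ ε : ℝ, 0 < ε → |u x - u 0| * c ≤ A * (ε / 2) := by
    intro ε hε
    have ht : Tendsto (fun R : ℝ => A * (ε / 2 + (2 * ε)⁻¹ *
        ⨍ y in Metric.ball (0 : Eucl d) R, |u y| ^ 2 / R ^ 2)) atTop
        (𝓝 (A * (ε / 2 + (2 * ε)⁻¹ * 0))) :=
      ((hsub.const_mul _).const_add _).const_mul _
    rw [mul_zero, add_zero] at ht
    refine ge_of_tendsto ht ?_
    filter_upwards [eventually_gt_atTop 0, eventually_gt_atTop (2 * ‖x‖)] with R hR hxR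
    refine (hbound R hR hxR).trans (mul_le_mul_of_nonneg_left ?_ hA)
    rw [hball R hR, hball R hR]
    have hm : ∫ y in Metric.ball (0 : Eucl d) R, |u y| / R ≤
        ∫ y in Metric.ball (0 : Eucl d) R, (ε / 2 + (2 * ε)⁻¹ * (|u y| ^ 2 / R ^ 2)) := by
      refine integral_mono (hion R _ (by fun_prop)).integrable
        (hion R _ (by fun_prop)).integrable fun y => ?_
      have := sq_nonneg (|u y| / R - ε)
      have e : ε / 2 + (2 * ε)⁻¹ * (|u y| ^ 2 / R ^ 2) - |u y| / R =
        (2 * ε)⁻¹ * (|u y| / R - ε) ^ 2 := by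
        field_simp
        ring
      have : 0 ≤ (2 * ε)⁻¹ * (|u y| / R - ε) ^ 2 := by positivity
      simp only
      linarith
    rw [integral_add (hion R _ (by fun_prop)).integrable (hion R _ (by fun_prop)).integrable,
      integral_const_mul, setIntegral_const, hvol R hR,
      finrank_euclideanSpace_fin, smul_eq_mul] at hm
    refine (mul_le_mul_of_nonneg_left hm (by positivity : 0 ≤ (R ^ d * v)⁻¹)).trans (le_of_eq ?_)
    field_simp
  have hle : |u x - u 0| * c ≤ 0 := by
    have ht : Tendsto (fun ε : ℝ => A * (ε / 2)) (𝓝[>] 0) (𝓝 (A * (0 / 2))) :=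
      ((by fun_prop : Continuous fun ε : ℝ => A * (ε / 2)).tendsto 0).mono_left nhdsWithin_le_nhds
    rw [zero_div, mul_zero] at ht
    exact ge_of_tendsto ht (eventually_mem_nhdsWithin.mono fun ε hε => hlim ε hε)
  have : |u x - u 0| = 0 := le_antisymm (by
    by_contra h
    exact absurd hle (not_le.2 (mul_pos (not_le.1 h) hpos))) (abs_nonneg _)
  exact sub_eq_zero.1 (abs_eq_zero.1 this)

/-! ### Isonormal Gaussian families -/

theorem integral_norm_le_norm_Lp_two {Ω : Type*} [MeasurableSpace Ω] {P : Measure Ω}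
    [IsProbabilityMeasure P] (f : Lp ℝ 2 P) : ∫ s, ‖f s‖ ∂P ≤ ‖f‖ := by
  rw [Lp.norm_def, integral_norm_eq_lintegral_enorm (Lp.aestronglyMeasurable f),
    ← eLpNorm_one_eq_lintegral_enorm]
  refine ENNReal.toReal_mono (Lp.eLpNorm_ne_top f) ?_
  exact eLpNorm_le_eLpNorm_of_exponent_le (by norm_num) (Lp.aestronglyMeasurable f)

/-- The characteristic function of the law is Lipschitz with respect to the `L²` norm, so it passes
to `L²` limits. -/
theorem continuous_charFun_map_Lp_two {Ω : Type*} [MeasurableSpace Ω] {P : Measure Ω}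
    [IsProbabilityMeasure P] (t : ℝ) :
    Continuous (fun f : Lp ℝ 2 P => charFun (P.map f) t) := by
  have key : ∀ f : Lp ℝ 2 P, charFun (P.map f) t = ∫ s, Complex.exp (t * f s * Complex.I) ∂P := by
    intro f
    rw [charFun_apply_real, integral_map (Lp.aestronglyMeasurable f).aemeasurable]
    exact (by fun_prop : Continuous fun x : ℝ =>
      Complex.exp (t * x * Complex.I)).aestronglyMeasurable
  have hint : ∀ f : Lp ℝ 2 P, Integrable (fun s => Complex.exp (t * f s * Complex.I)) P := by
    intro f
    refine Integrable.of_bound (C := 1) ?_ (Eventually.of_forall fun s => ?_)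
    · exact (by fun_prop : Continuous fun x : ℝ =>
        Complex.exp (t * x * Complex.I)).comp_aestronglyMeasurable (Lp.aestronglyMeasurable f)
    · rw [← Complex.ofReal_mul, Complex.norm_exp_ofReal_mul_I]
  have hexp : ∀ a b : ℝ, ‖Complex.exp (a * Complex.I) - Complex.exp (b * Complex.I)‖ ≤ |a - b| := by
    intro a b
    have h1 : Complex.exp (a * Complex.I) - Complex.exp (b * Complex.I)
        = Complex.exp (b * Complex.I) * (Complex.exp (Complex.I * ((a - b : ℝ) : ℂ)) - 1) := by
      rw [mul_sub, ← Complex.exp_add, mul_one]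
      congr 2
      push_cast
      ring
    rw [h1, norm_mul, Complex.norm_exp_ofReal_mul_I, one_mul]
    exact Real.norm_exp_I_mul_ofReal_sub_one_le
  refine (LipschitzWith.of_dist_le_mul (K := ⟨|t|, abs_nonneg t⟩) fun f g => ?_).continuous
  rw [dist_eq_norm, dist_eq_norm, key, key, ← integral_sub (hint f) (hint g)]
  calc ‖∫ s, (Complex.exp (t * f s * Complex.I) - Complex.exp (t * g s * Complex.I)) ∂P‖
      ≤ ∫ s, |t| * ‖(f - g : Lp ℝ 2 P) s‖ ∂P := by
        refine norm_integral_le_of_norm_le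
          (((Lp.memLp (f - g)).integrable (by norm_num)).norm.const_mul _) ?_
        filter_upwards [Lp.coeFn_sub f g] with s hs
        have := hexp (t * f s) (t * g s)
        push_cast at this
        refine this.trans (le_of_eq ?_)
        rw [hs, Pi.sub_apply, ← mul_sub, abs_mul, Real.norm_eq_abs]
    _ = |t| * ∫ s, ‖(f - g : Lp ℝ 2 P) s‖ ∂P := integral_const_mul _ _
    _ ≤ |t| * ‖f - g‖ := by gcongr; exact integral_norm_le_norm_Lp_two _

/-- Every real Hilbert space carries an isonormal Gaussian family: a linear isometry into some
`L²(P)` all of whose values are centered Gaussian. -/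
theorem exists_isonormal (H : Type) [NormedAddCommGroup H] [InnerProductSpace ℝ H]
    [CompleteSpace H] :
    ∃ (Ω : Type) (_ : MeasurableSpace Ω) (P : Measure Ω) (_ : IsProbabilityMeasure P)
      (W : H →ₗᵢ[ℝ] Lp ℝ 2 P), ∀ h, P.map (W h) = gaussianReal 0 (‖h‖₊ ^ 2) := by
  obtain ⟨ι, b, -⟩ := exists_hilbertBasis ℝ H
  let P : Measure (ι → ℝ) := Measure.infinitePi fun _ => gaussianReal 0 1
  have hmeas : ∀ i, Measurable fun s : ι → ℝ => s i := fun i => measurable_pi_apply i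
  have hlaw : ∀ i, P.map (fun s => s i) = gaussianReal 0 1 := fun i =>
    (measurePreserving_eval_infinitePi (fun _ : ι => gaussianReal 0 1) i).map_eq
  have hgauss : ∀ i, HasGaussianLaw (fun s : ι → ℝ => s i) P := fun i =>
    ⟨by rw [hlaw i]; infer_instance⟩
  have hind : iIndepFun (fun i (s : ι → ℝ) => s i) P :=
    iIndepFun_infinitePi (P := fun _ : ι => gaussianReal 0 1) (X := fun _ x => x)
      (fun _ => measurable_id)
  have hmean : ∀ i, ∫ s, s i ∂P = 0 := by
    intro i
    have := integral_map (μ := P) (φ := fun s => s i) (hmeas i).aemeasurable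
      (f := fun x : ℝ => x) (by fun_prop)
    rw [← this, hlaw, integral_id_gaussianReal]
  have hvar : ∀ i, ∫ s, s i * s i ∂P = 1 := by
    intro i
    have h := variance_eq_integral (μ := P) (X := fun s => s i) (hmeas i).aemeasurable
    have h2 : variance (fun s => s i) P = 1 := by
      have := variance_map (μ := P) (X := fun x : ℝ => x) (Y := fun s => s i)
        (by fun_prop) (hmeas i).aemeasurable
      rw [hlaw] at this
      have h3 := variance_fun_id_gaussianReal (μ := 0) (v := 1)
      rw [h3] at this
      simpa [Function.comp_def] using this.symm
    rw [h2, hmean] at h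
    rw [h]
    congr 1
    ext s
    ring
  let ξ : ι → Lp ℝ 2 P := fun i => ((hgauss i).memLp_two).toLp _
  have hξ : ∀ i, ξ i =ᵐ[P] fun s => s i := fun i => MemLp.coeFn_toLp _
  have hortho : Orthonormal ℝ ξ := by
    classical
    rw [orthonormal_iff_ite]
    intro i j
    have h1 : inner ℝ (ξ i) (ξ j) = ∫ s, s i * s j ∂P := by
      rw [L2.inner_def]
      refine integral_congr_ae ?_
      filter_upwards [hξ i, hξ j] with s h1 h2
      rw [h1, h2]
      simp [mul_comm]
    rw [h1]
    split_ifs with hij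
    · subst hij
      exact hvar i
    · rw [(hind.indepFun hij).integral_fun_mul_eq_mul_integral
        (hmeas i).aestronglyMeasurable (hmeas j).aestronglyMeasurable, hmean, zero_mul]
  let W : H →ₗᵢ[ℝ] Lp ℝ 2 P :=
    hortho.orthogonalFamily.linearIsometry.comp b.repr.toLinearIsometry
  have hWb : ∀ i, W (b i) = ξ i := by
    intro i
    classical
    simp [W, HilbertBasis.repr_self, OrthogonalFamily.linearIsometry_apply_single]
  refine ⟨ι → ℝ, inferInstance, P, inferInstance, W, fun h => ?_⟩
  -- finite linear combinations of the basis
  have hfin : ∀ (S : Finset ι) (c : ι → ℝ),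
      P.map (W (∑ i ∈ S, c i • b i)) = gaussianReal 0 (‖∑ i ∈ S, c i • b i‖₊ ^ 2) := by
    intro S c
    have hae : W (∑ i ∈ S, c i • b i) =ᵐ[P] fun s => ∑ i : S, c i * s i := by
      have h1 : W (∑ i ∈ S, c i • b i) = ∑ i ∈ S, c i • ξ i := by
        simp only [map_sum, map_smul, hWb]
      rw [h1]
      have h2 : ∀ᵐ s ∂P, ∀ i : S, (c i • ξ i : Lp ℝ 2 P) s = c i * s i := by
        rw [ae_all_iff]
        intro i
        filter_upwards [Lp.coeFn_smul (c i) (ξ i), hξ i] with s h1 h2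
        rw [h1, Pi.smul_apply, h2, smul_eq_mul]
      filter_upwards [h2, Lp.coeFn_finsetSum S fun i => c i • ξ i] with s h2 h3
      rw [h3, Finset.sum_apply, ← Finset.sum_coe_sort]
      exact Finset.sum_congr rfl fun i _ => h2 i
    have hg : HasGaussianLaw (fun s : ι → ℝ => ∑ i : S, c i * s i) P := by
      refine iIndepFun.hasGaussianLaw_fun_sum (X := fun (i : S) (s : ι → ℝ) => c i * s i)
        (fun i => (hgauss i).fun_smul (c i)) ?_
      exact (hind.precomp Subtype.val_injective).comp (fun (i : S) x => c i * x) (fun i => by fun_prop)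
    have hm : ∫ s : ι → ℝ, ∑ i : S, c i * s i ∂P = 0 := by
      rw [integral_finsetSum]
      · simp only [integral_const_mul, hmean, mul_zero, Finset.sum_const_zero]
      · intro i _
        exact ((hgauss i).integrable).const_mul _
    rw [Measure.map_congr hae, hg.map_eq_gaussianReal, hm]
    congr 1
    have hv : variance (fun s : ι → ℝ => ∑ i : S, c i * s i) P = ‖∑ i ∈ S, c i • b i‖ ^ 2 := by
      rw [variance_eq_integral hg.aemeasurable, hm, ← LinearIsometry.norm_map W,
        ← real_inner_self_eq_norm_sq, L2.inner_def]
      refine integral_congr_ae ?_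
      filter_upwards [hae] with s hs
      rw [hs]
      simp [pow_two]
    rw [hv]
    ext
    simp
  -- pass to the limit along the basis expansion
  have hprob : IsProbabilityMeasure (P.map (W h)) :=
    Measure.isProbabilityMeasure_map (Lp.aestronglyMeasurable _).aemeasurable
  refine Measure.ext_of_charFun (funext fun t => ?_)
  have hsum : Tendsto (fun S : Finset ι => ∑ i ∈ S, b.repr h i • b i) atTop (𝓝 h) :=
    b.hasSum_repr h
  have h1 := ((continuous_charFun_map_Lp_two (P := P) t).comp W.continuous).tendsto h |>.comp hsum
  have h2 : Tendsto (fun S : Finset ι => charFun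
      (gaussianReal 0 (‖∑ i ∈ S, b.repr h i • b i‖₊ ^ 2)) t) atTop
      (𝓝 (charFun (gaussianReal 0 (‖h‖₊ ^ 2)) t)) := by
    simp only [charFun_gaussianReal]
    have hc : Continuous fun x : H => Complex.exp (t * (0 : ℝ) * Complex.I
        - ((‖x‖₊ ^ 2 : NNReal) : ℂ) * t ^ 2 / 2) := by
      have : Continuous fun x : H => (((‖x‖ ^ 2 : ℝ)) : ℂ) := by fun_prop
      simp only [NNReal.coe_pow, coe_nnnorm]
      fun_prop
    exact (hc.tendsto h).comp hsum
  refine tendsto_nhds_unique h1 (h2.congr fun S => ?_)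
  simp only [Function.comp_apply, hfin]

/-! ### Plane waves and the linearized equation -/

/-- The Fourier symbol `⟨e, k⟩ / |k|²` of the solution operator `ω ↦ φ`, up to the factor `i`. At
`k = 0`, where `ω` is constant and `φ` vanishes, it is `0`. -/
noncomputable def correctorSymbol {d : ℕ} (e k : Eucl d) : ℝ := inner ℝ e k / ‖k‖ ^ 2

theorem abs_correctorSymbol_mul_norm_le {d : ℕ} {e : Eucl d} (he : ‖e‖ = 1) (k : Eucl d) :
    |correctorSymbol e k| * ‖k‖ ≤ 1 := by
  rcases eq_or_ne k 0 with rfl | hk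
  · simp
  have hk' : 0 < ‖k‖ := norm_pos_iff.2 hk
  rw [correctorSymbol, abs_div, abs_of_pos (by positivity : 0 < ‖k‖ ^ 2), div_mul_eq_mul_div,
    div_le_one (by positivity)]
  have := abs_real_inner_le_norm e k
  rw [he, one_mul] at this
  nlinarith

theorem measurable_correctorSymbol {d : ℕ} (e : Eucl d) : Measurable (correctorSymbol e) := by
  unfold correctorSymbol
  fun_prop

/-- The Hartley kernel `cos ⟨k, y⟩ + sin ⟨k, y⟩`, a real substitute for `exp (i ⟨k, y⟩)`. -/
noncomputable def planeWave {d : ℕ} (y k : Eucl d) : ℝ :=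
  Real.cos (inner ℝ k y) + Real.sin (inner ℝ k y)

/-- The solution of the linearized equation whose right-hand side is the Hartley kernel,
normalized to vanish at the origin. -/
noncomputable def correctorWave {d : ℕ} (e y k : Eucl d) : ℝ :=
  correctorSymbol e k * (Real.cos (inner ℝ k y) - Real.sin (inner ℝ k y) - 1)

theorem abs_planeWave_le {d : ℕ} (y k : Eucl d) : |planeWave y k| ≤ 2 := by
  have h1 := Real.abs_cos_le_one (inner ℝ k y)
  have h2 := Real.abs_sin_le_one (inner ℝ k y)
  exact (abs_add_le _ _).trans (by linarith)

theorem abs_correctorWave_le {d : ℕ} {e : Eucl d} (he : ‖e‖ = 1) (y k : Eucl d) :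
    |correctorWave e y k| ≤ 2 * ‖y‖ := by
  have h1 : |Real.cos (inner ℝ k y) - Real.sin (inner ℝ k y) - 1| ≤ 2 * (‖k‖ * ‖y‖) := by
    have ht := abs_real_inner_le_norm k y
    set t : ℝ := inner ℝ k y
    have hs : |Real.sin t| ≤ |t| := Real.abs_sin_le_abs
    have hc : |Real.cos t - 1| ≤ |t| := by
      have e1 : Real.cos t - 1 = -(2 * Real.sin (t / 2) ^ 2) := by
        rw [Real.sin_sq_eq_half_sub, mul_div_cancel₀ t two_ne_zero]
        ring
      rw [e1, abs_neg, abs_of_nonneg (by positivity)]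
      have h2 : |Real.sin (t / 2)| ≤ |t / 2| := Real.abs_sin_le_abs
      have h3 := Real.abs_sin_le_one (t / 2)
      have h4 : Real.sin (t / 2) ^ 2 = |Real.sin (t / 2)| * |Real.sin (t / 2)| := by
        rw [abs_mul_abs_self, sq]
      rw [abs_div, abs_two] at h2
      rw [h4]
      nlinarith [abs_nonneg (Real.sin (t / 2))]
    calc |Real.cos t - Real.sin t - 1| = |(Real.cos t - 1) - Real.sin t| := by congr 1; ring
      _ ≤ |Real.cos t - 1| + |Real.sin t| := abs_sub _ _
      _ ≤ _ := by linarith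
  rw [correctorWave, abs_mul]
  calc _ ≤ |correctorSymbol e k| * (2 * (‖k‖ * ‖y‖)) := by gcongr
    _ = 2 * ‖y‖ * (|correctorSymbol e k| * ‖k‖) := by ring
    _ ≤ 2 * ‖y‖ * 1 := by gcongr; exact abs_correctorSymbol_mul_norm_le he k
    _ = _ := mul_one _

theorem integral_mul_fderiv_eq_of_hasCompactSupport {d : ℕ} {f ζ : Eucl d → ℝ}
    (hf : ContDiff ℝ 1 f) (hζ : ContDiff ℝ 1 ζ) (hζs : HasCompactSupport ζ) (v : Eucl d) :
    ∫ y, f y * fderiv ℝ ζ y v = -∫ y, fderiv ℝ f y v * ζ y := by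
  have h1 : Continuous fun y => fderiv ℝ ζ y v := (hζ.continuous_fderiv (by simp)).clm_apply
    continuous_const
  have h2 : Continuous fun y => fderiv ℝ f y v := (hf.continuous_fderiv (by simp)).clm_apply
    continuous_const
  have h3 : HasCompactSupport fun y => fderiv ℝ ζ y v := hζs.fderiv_apply (𝕜 := ℝ) v
  refine integral_mul_fderiv_eq_neg_fderiv_mul_of_integrable ?_ ?_ ?_
    (fun x _ => hf.differentiable (by simp) x) (fun x _ => hζ.differentiable (by simp) x)
  · exact (h2.mul hζ.continuous).integrable_of_hasCompactSupport hζs.mul_left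
  · exact (hf.continuous.mul h1).integrable_of_hasCompactSupport h3.mul_left
  · exact (hf.continuous.mul hζ.continuous).integrable_of_hasCompactSupport hζs.mul_left

theorem integral_planeWave_mul_fderiv {d : ℕ} {ζ : Eucl d → ℝ} (hζ : ContDiff ℝ 1 ζ)
    (hζs : HasCompactSupport ζ) (k v : Eucl d) :
    ∫ y, planeWave y k * fderiv ℝ ζ y v =
      -(inner ℝ k v * ∫ y, (Real.cos (inner ℝ k y) - Real.sin (inner ℝ k y)) * ζ y) := by
  have hf : ∀ y, HasFDerivAt (fun y => planeWave y k)
      ((Real.cos (inner ℝ k y) - Real.sin (inner ℝ k y)) • innerSL ℝ k) y := by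
    intro y
    have hi : HasFDerivAt (fun y : Eucl d => (inner ℝ k y : ℝ)) (innerSL ℝ k) y :=
      (innerSL ℝ k).hasFDerivAt
    refine (hi.cos.add hi.sin).congr_fderiv ?_
    module
  have hc : ContDiff ℝ 1 (fun y => planeWave y k) := by
    unfold planeWave
    exact (Real.contDiff_cos.comp (contDiff_const.inner ℝ contDiff_id)).add
      (Real.contDiff_sin.comp (contDiff_const.inner ℝ contDiff_id))
  rw [integral_mul_fderiv_eq_of_hasCompactSupport hc hζ hζs, ← integral_const_mul]
  congr 1
  refine integral_congr_ae (Eventually.of_forall fun y => ?_)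
  simp only [(hf y).fderiv]
  change (_ * inner ℝ k v) * ζ y = _
  ring

/-- Plane waves solve the linearized equation frequency by frequency. -/
theorem integral_correctorWave_mul_laplacian {d : ℕ} {ζ : Eucl d → ℝ}
    (hζ : ContDiff ℝ (⊤ : ℕ∞) ζ) (hζs : HasCompactSupport ζ) (e k : Eucl d) :
    ∫ y, correctorWave e y k * Laplacian.laplacian ζ y =
      ∫ y, planeWave y k * fderiv ℝ ζ y e := by
  have hζ1 : ContDiff ℝ 1 ζ := hζ.of_le (by exact_mod_cast le_top)
  have hζ' : ContDiff ℝ 1 (fderiv ℝ ζ) := (hζ.fderiv_right (m := (⊤ : ℕ∞)) (by simp)).of_le (by exact_mod_cast le_top)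
  let C : Eucl d → ℝ := fun y => Real.cos (inner ℝ k y) - Real.sin (inner ℝ k y) - 1
  have hC : ∀ y, HasFDerivAt C (-(planeWave y k) • innerSL ℝ k) y := by
    intro y
    have hi : HasFDerivAt (fun y : Eucl d => (inner ℝ k y : ℝ)) (innerSL ℝ k) y :=
      (innerSL ℝ k).hasFDerivAt
    refine ((hi.cos.sub hi.sin).sub_const 1).congr_fderiv ?_
    rw [planeWave]
    module
  have hCc : ContDiff ℝ 1 C :=
    ((Real.contDiff_cos.comp (contDiff_const.inner ℝ contDiff_id)).sub
      (Real.contDiff_sin.comp (contDiff_const.inner ℝ contDiff_id))).sub contDiff_const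
  have hpc : Continuous fun y => planeWave y k := by
    unfold planeWave
    fun_prop
  let b := stdOrthonormalBasis ℝ (Eucl d)
  have hlap : ∀ y, Laplacian.laplacian ζ y = ∑ i, fderiv ℝ (fun z => fderiv ℝ ζ z (b i)) y (b i) := by
    intro y
    rw [InnerProductSpace.laplacian_eq_iteratedFDeriv_stdOrthonormalBasis]
    refine Finset.sum_congr rfl fun i _ => ?_
    rw [iteratedFDeriv_two_apply, fderiv_clm_apply (hζ'.differentiable (by simp) y) (by fun_prop)]
    simp [b]
  have hterm : ∀ i, ∫ y, C y * fderiv ℝ (fun z => fderiv ℝ ζ z (b i)) y (b i) =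
      inner ℝ k (b i) * ∫ y, planeWave y k * fderiv ℝ ζ y (b i) := by
    intro i
    rw [integral_mul_fderiv_eq_of_hasCompactSupport hCc (hζ'.clm_apply contDiff_const)
      (hζs.fderiv_apply (𝕜 := ℝ) (b i)), ← integral_const_mul, ← integral_neg]
    refine integral_congr_ae (Eventually.of_forall fun y => ?_)
    simp only [(hC y).fderiv]
    change -((-planeWave y k * inner ℝ k (b i)) * _) = _
    ring
  have hlapC : ∫ y, C y * Laplacian.laplacian ζ y = ∫ y, planeWave y k * fderiv ℝ ζ y k := by
    simp only [hlap, Finset.mul_sum]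
    rw [integral_finsetSum]
    · simp only [hterm, ← integral_const_mul]
      rw [← integral_finsetSum]
      · refine integral_congr_ae (Eventually.of_forall fun y => ?_)
        have h := congrArg (fderiv ℝ ζ y) (b.sum_repr' k)
        rw [map_sum] at h
        simp only [map_smul, smul_eq_mul] at h
        simp only
        rw [← h, Finset.mul_sum]
        refine Finset.sum_congr rfl fun i _ => ?_
        rw [real_inner_comm]
        ring
      · intro i _
        refine Integrable.const_mul ?_ _
        exact (hpc.mul (hζ'.continuous.clm_apply continuous_const)).integrable_of_hasCompactSupport
          (hζs.fderiv_apply (𝕜 := ℝ) (b i)).mul_left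
    · intro i _
      have h1 : ContDiff ℝ (⊤ : ℕ∞) fun z => fderiv ℝ ζ z (b i) :=
        (hζ.fderiv_right (by simp)).clm_apply contDiff_const
      refine (hCc.continuous.mul ((h1.continuous_fderiv (by simp)).clm_apply
        continuous_const)).integrable_of_hasCompactSupport ?_
      exact ((hζs.fderiv_apply (𝕜 := ℝ) (b i)).fderiv_apply (𝕜 := ℝ) (b i)).mul_left
  have h1 : ∫ y, correctorWave e y k * Laplacian.laplacian ζ y =
      correctorSymbol e k * ∫ y, C y * Laplacian.laplacian ζ y := by
    rw [← integral_const_mul]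
    refine integral_congr_ae (Eventually.of_forall fun y => ?_)
    simp only [correctorWave, C, mul_assoc]
  rw [h1, hlapC, integral_planeWave_mul_fderiv hζ1 hζs, integral_planeWave_mul_fderiv hζ1 hζs]
  rcases eq_or_ne k 0 with rfl | hk
  · simp
  have hk' : ‖k‖ ≠ 0 := norm_ne_zero_iff.2 hk
  rw [correctorSymbol, real_inner_self_eq_norm_sq, real_inner_comm]
  field_simp

/-! ### Square-summable families in Hilbert spaces -/

section SquareSummable

variable {J : Type} {H : Type} [NormedAddCommGroup H] [InnerProductSpace ℝ H] [CompleteSpace H]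

/-- A square-summable family `v` of vectors defines a bounded operator `a ↦ ∑ a_j v_j` on `ℓ²`. -/
theorem exists_clm_hasSum_smul (v : J → H) (hv : Summable fun j => ‖v j‖ ^ 2) :
    ∃ T : lp (fun _ : J => ℝ) 2 →L[ℝ] H, ∀ a, HasSum (fun j => a j • v j) (T a) := by
  let nv : lp (fun _ : J => ℝ) 2 := ⟨fun j => ‖v j‖, memℓp_gen (by simpa using hv)⟩
  have hb : ∀ a : lp (fun _ : J => ℝ) 2, (Summable fun j => ‖a j • v j‖) ∧
      ∑' j, ‖a j • v j‖ ≤ ‖a‖ * ‖nv‖ := by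
    intro a
    have h := lp.tsum_mul_le_mul_norm (p := 2) (q := 2) (by norm_num [Real.holderConjugate_iff]) a nv
    simpa [norm_smul, nv] using h
  have hs : ∀ a : lp (fun _ : J => ℝ) 2, HasSum (fun j => a j • v j) (∑' j, a j • v j) :=
    fun a => (hb a).1.of_norm.hasSum
  let T : lp (fun _ : J => ℝ) 2 →ₗ[ℝ] H :=
    { toFun := fun a => ∑' j, a j • v j
      map_add' := fun a b => by
        refine HasSum.tsum_eq ?_
        simpa only [lp.coeFn_add, Pi.add_apply, add_smul] using (hs a).add (hs b)
      map_smul' := fun c a => by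
        refine HasSum.tsum_eq ?_
        simpa only [lp.coeFn_smul, Pi.smul_apply, smul_assoc, RingHom.id_apply] using
          (hs a).const_smul c }
  refine ⟨T.mkContinuous ‖nv‖ fun a => ?_, hs⟩
  rw [mul_comm]
  exact (norm_tsum_le_tsum_norm (hb a).1).trans (hb a).2

variable {α : Type} [MeasurableSpace α] {μ : Measure α}

/-- A series which converges both in `L²` and pointwise has the same sum in both senses. -/
theorem ae_eq_of_hasSum_Lp [Countable J] {f : J → Lp ℝ 2 μ} {F : Lp ℝ 2 μ} (hF : HasSum f F)
    {w : J → α → ℝ} (hw : ∀ j, f j =ᵐ[μ] w j) {g : α → ℝ}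
    (hg : ∀ᵐ k ∂μ, HasSum (fun j => w j k) (g k)) : F =ᵐ[μ] g := by
  have hm : TendstoInMeasure μ (fun S : Finset J => ((∑ j ∈ S, f j : Lp ℝ 2 μ) : α → ℝ)) atTop F :=
    tendstoInMeasure_of_tendsto_Lp hF
  obtain ⟨ns, hns, hae⟩ := hm.exists_seq_tendsto_ae'
  have hw' : ∀ᵐ k ∂μ, ∀ j, f j k = w j k := ae_all_iff.2 hw
  have hsum : ∀ᵐ k ∂μ, ∀ n, (∑ j ∈ ns n, f j : Lp ℝ 2 μ) k = ∑ j ∈ ns n, f j k := by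
    refine ae_all_iff.2 fun n => ?_
    filter_upwards [Lp.coeFn_finsetSum (ns n) f] with k hk
    rw [hk, Finset.sum_apply]
  filter_upwards [hae, hw', hsum, hg] with k h1 h2 h3 h4
  refine tendsto_nhds_unique h1 ((h4.comp hns).congr fun n => ?_)
  simp only [Function.comp_apply, h3, h2]

/-- Pointwise domination of the squares by one integrable function makes a family of functions a
square-summable family of vectors of `L²`. -/
theorem exists_Lp_summable_norm_sq {w : J → α → ℝ} (hw : ∀ j, Measurable (w j)) {G : α → ℝ}
    (hG : Integrable G μ) (hwG : ∀ (S : Finset J) k, ∑ j ∈ S, w j k ^ 2 ≤ G k) :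
    ∃ v : J → Lp ℝ 2 μ, (∀ j, v j =ᵐ[μ] w j) ∧ Summable fun j => ‖v j‖ ^ 2 := by
  have hint : ∀ j, Integrable (fun k => w j k ^ 2) μ := by
    intro j
    refine hG.mono' ((hw j).pow_const 2).aestronglyMeasurable (Eventually.of_forall fun k => ?_)
    rw [Real.norm_of_nonneg (sq_nonneg _)]
    simpa using hwG {j} k
  have hL : ∀ j, MemLp (w j) 2 μ := fun j =>
    (memLp_two_iff_integrable_sq (hw j).aestronglyMeasurable).2 (hint j)
  refine ⟨fun j => (hL j).toLp _, fun j => (hL j).coeFn_toLp, ?_⟩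
  have hnorm : ∀ j, ‖(hL j).toLp‖ ^ 2 = ∫ k, w j k ^ 2 ∂μ := by
    intro j
    rw [← real_inner_self_eq_norm_sq, L2.inner_def]
    refine integral_congr_ae ?_
    filter_upwards [(hL j).coeFn_toLp] with k hk
    rw [hk]
    simp [sq]
  refine summable_of_sum_le (c := ∫ k, G k ∂μ) (fun _ => sq_nonneg _) fun S => ?_
  simp only [hnorm]
  rw [← integral_finsetSum S fun j _ => hint j]
  exact integral_mono (integrable_finsetSum S fun j _ => hint j) hG (hwG S)

/-- A square-summable family of vectors of `L²(P)` is realized by a random element `X` of `ℓ²`: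
the value `⟨X, a⟩` is a version of the sum of the series `∑ a_j V_j` in `L²(P)`. -/
theorem exists_random_l2 [Countable J] {Ω : Type} [MeasurableSpace Ω] {P : Measure Ω}
    (V : J → Lp ℝ 2 P) (hV : Summable fun j => ‖V j‖ ^ 2) :
    ∃ X : Ω → lp (fun _ : J => ℝ) 2, (∀ a, Measurable fun s => (inner ℝ (X s) a : ℝ)) ∧
      ∀ (a : lp (fun _ : J => ℝ) 2) (F : Lp ℝ 2 P), HasSum (fun j => a j • V j) F →
        F =ᵐ[P] fun s => (inner ℝ (X s) a : ℝ) := by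
  have hm : ∀ j, Measurable (V j) := fun j => (Lp.stronglyMeasurable (V j)).measurable
  -- the set where the coordinates are square-summable has full measure
  let A : Set Ω := {s | ∑' j, ENNReal.ofReal (V j s ^ 2) < ⊤}
  have hAm : MeasurableSet A := measurableSet_lt
    (Measurable.tsum fun j => ((hm j).pow_const 2).ennreal_ofReal) measurable_const
  have hA : ∀ᵐ s ∂P, s ∈ A := by
    refine ae_lt_top (Measurable.tsum fun j => ((hm j).pow_const 2).ennreal_ofReal) ?_
    rw [lintegral_tsum fun j => (((hm j).pow_const 2).ennreal_ofReal).aemeasurable]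
    have hj : ∀ j, ∫⁻ s, ENNReal.ofReal (V j s ^ 2) ∂P = ENNReal.ofReal (‖V j‖ ^ 2) := by
      intro j
      rw [← ofReal_integral_eq_lintegral_ofReal (Lp.memLp (V j)).integrable_sq
        (Eventually.of_forall fun s => sq_nonneg _), ← real_inner_self_eq_norm_sq, L2.inner_def]
      congr 1
      refine integral_congr_ae (Eventually.of_forall fun s => ?_)
      simp [sq]
    simp only [hj]
    rw [← ENNReal.ofReal_tsum_of_nonneg (fun _ => sq_nonneg _) hV]
    exact ENNReal.ofReal_ne_top
  classical
  let x : Ω → J → ℝ := fun s j => if s ∈ A then V j s else 0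
  have hx : ∀ s, Memℓp (x s) 2 := by
    intro s
    refine memℓp_gen ?_
    by_cases hs : s ∈ A
    · have h := ENNReal.summable_toReal (ne_of_lt hs)
      simpa [x, hs, ENNReal.toReal_ofReal, sq_nonneg] using h
    · simp [x, hs, summable_zero]
  have hxm : ∀ j, Measurable fun s => x s j := fun j =>
    Measurable.ite hAm (hm j) measurable_const
  let X : Ω → lp (fun _ : J => ℝ) 2 := fun s => ⟨x s, hx s⟩
  have hX : ∀ s (a : lp (fun _ : J => ℝ) 2), HasSum (fun j => a j * x s j) (inner ℝ (X s) a) := by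
    intro s a
    simpa [X] using lp.hasSum_inner (𝕜 := ℝ) (X s) a
  refine ⟨X, fun a => ?_, fun a F hF => ?_⟩
  · refine measurable_of_tendsto_metrizable' (atTop : Filter (Finset J))
      (f := fun S s => ∑ j ∈ S, a j * x s j) (fun S => ?_) ?_
    · exact Finset.measurable_fun_sum _ fun j _ => (hxm j).const_mul _
    · exact tendsto_pi_nhds.2 fun s => hX s a
  · refine ae_eq_of_hasSum_Lp hF (w := fun j s => a j * x s j) (fun j => ?_)
      (Eventually.of_forall fun s => hX s a)
    filter_upwards [Lp.coeFn_smul (a j) (V j), hA] with s h1 h2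
    rw [h1]
    simp [x, h2]

theorem isSeparable_l2 [Countable J] : TopologicalSpace.IsSeparable
    (Set.univ : Set (lp (fun _ : J => ℝ) 2)) := by
  let b : HilbertBasis J ℝ (lp (fun _ : J => ℝ) 2) :=
    HilbertBasis.ofRepr (LinearIsometryEquiv.refl ℝ _)
  have h := ((Set.countable_range b).isSeparable.span (R := ℝ)).closure
  have h2 := congrArg (fun S : Submodule ℝ _ => (S : Set (lp (fun _ : J => ℝ) 2))) b.dense_span
  rw [Submodule.topologicalClosure_coe] at h2
  rw [h2] at h
  simpa using h

/-- Linear relations that hold almost surely one at a time hold almost surely simultaneously, by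
separability of `ℓ²`. -/
theorem ae_forall_inner_add_inner_eq_zero [Countable J] {Ω : Type} [MeasurableSpace Ω]
    {P : Measure Ω} (X Y : Ω → lp (fun _ : J => ℝ) 2) :
    ∀ᵐ s ∂P, ∀ a b : lp (fun _ : J => ℝ) 2,
      (∀ᵐ s ∂P, (inner ℝ (X s) a : ℝ) + inner ℝ (Y s) b = 0) →
        (inner ℝ (X s) a : ℝ) + inner ℝ (Y s) b = 0 := by
  let K : Set (lp (fun _ : J => ℝ) 2 × lp (fun _ : J => ℝ) 2) :=
    {p | ∀ᵐ s ∂P, (inner ℝ (X s) p.1 : ℝ) + inner ℝ (Y s) p.2 = 0}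
  have hsep : TopologicalSpace.IsSeparable K :=
    (isSeparable_l2.prod isSeparable_l2).mono fun p _ => ⟨Set.mem_univ _, Set.mem_univ _⟩
  obtain ⟨t, htK, htc, hKt⟩ := hsep.exists_countable_dense_subset
  have hall : ∀ᵐ s ∂P, ∀ p ∈ t, (inner ℝ (X s) p.1 : ℝ) + inner ℝ (Y s) p.2 = 0 :=
    (ae_ball_iff htc).2 fun p hp => htK hp
  filter_upwards [hall] with s hs a b hab
  have hcl : IsClosed {p : lp (fun _ : J => ℝ) 2 × lp (fun _ : J => ℝ) 2 |
      (inner ℝ (X s) p.1 : ℝ) + inner ℝ (Y s) p.2 = 0} :=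
    isClosed_eq (by fun_prop) continuous_const
  have hab' : (a, b) ∈ K := hab
  exact closure_minimal (fun p hp => hs p hp) hcl (hKt hab')

end SquareSummable

/-! ### Fock space expansions -/

/-- Index set of the (non-commutative) monomials in `d` variables: words in `Fin d`. -/
abbrev Word (d : ℕ) : Type := Σ n : ℕ, (Fin n → Fin d)

/-- The monomial attached to a word. -/
noncomputable def wordMonomial {d : ℕ} (j : Word d) (x : Eucl d) : ℝ := ∏ i, x (j.2 i)

theorem continuous_wordMonomial {d : ℕ} (j : Word d) : Continuous (wordMonomial j) := by
  unfold wordMonomial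
  fun_prop

theorem sum_wordMonomial_mul {d : ℕ} (n : ℕ) (x y : Eucl d) :
    ∑ f : Fin n → Fin d, wordMonomial ⟨n, f⟩ x * wordMonomial ⟨n, f⟩ y = inner ℝ x y ^ n := by
  have h : (inner ℝ x y : ℝ) = ∑ i, x i * y i := by
    simp [PiLp.inner_apply, mul_comm]
  rw [h, Fintype.sum_pow]
  refine Finset.sum_congr rfl fun f _ => ?_
  rw [wordMonomial, wordMonomial, ← Finset.prod_mul_distrib]

/-- A power series in `⟨x, y⟩` whose coefficients are dominated by those of the exponential,
written as an absolutely convergent series over words. -/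
theorem hasSum_word_of_hasSum {d : ℕ} {c : ℕ → ℝ} (hc : ∀ n, |c n| ≤ (n.factorial : ℝ)⁻¹)
    (x y : Eucl d) {S : ℝ} (hS : HasSum (fun n => c n * inner ℝ x y ^ n) S) :
    HasSum (fun j : Word d => c j.1 * (wordMonomial j x * wordMonomial j y)) S := by
  refine HasSum.sigma_of_hasSum hS (fun n => ?_) ?_
  · rw [← sum_wordMonomial_mul, Finset.mul_sum]
    exact hasSum_fintype _
  · refine Summable.of_norm ((summable_sigma_of_nonneg fun _ => norm_nonneg _).2
      ⟨fun n => (hasSum_fintype _).summable, ?_⟩)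
    refine Summable.of_nonneg_of_le (fun n => tsum_nonneg fun _ => norm_nonneg _) (fun n => ?_)
      (Real.summable_pow_div_factorial (∑ i, |x i| * |y i|))
    rw [tsum_fintype, Fintype.sum_pow, div_eq_inv_mul, Finset.mul_sum]
    refine Finset.sum_le_sum fun f _ => ?_
    rw [norm_mul, Real.norm_eq_abs, Real.norm_eq_abs]
    have : |wordMonomial ⟨n, f⟩ x * wordMonomial ⟨n, f⟩ y| = ∏ i, |x (f i)| * |y (f i)| := by
      rw [wordMonomial, wordMonomial, abs_mul, Finset.abs_prod, Finset.abs_prod,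
        Finset.prod_mul_distrib]
    rw [this]
    exact mul_le_mul_of_nonneg_right (hc n) (by positivity)

theorem hasSum_exp_word {d : ℕ} (x y : Eucl d) :
    HasSum (fun j : Word d => (j.1.factorial : ℝ)⁻¹ * (wordMonomial j x * wordMonomial j y))
      (Real.exp (inner ℝ x y)) := by
  refine hasSum_word_of_hasSum (c := fun n => (n.factorial : ℝ)⁻¹) (fun n => ?_) x y ?_
  · rw [abs_of_nonneg (by positivity)]
  · have h := NormedSpace.expSeries_div_hasSum_exp (inner ℝ x y : ℝ)
    rw [← Real.exp_eq_exp_ℝ] at h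
    simpa only [div_eq_inv_mul] using h

theorem memℓp_fockVector {d : ℕ} (x : Eucl d) :
    Memℓp (fun j : Word d => wordMonomial j x / √(j.1.factorial : ℝ)) 2 := by
  refine memℓp_gen ((hasSum_exp_word x x).summable.congr fun j => ?_)
  have : (0 : ℝ) ≤ (j.1.factorial : ℝ) := by positivity
  simp [div_pow, Real.sq_sqrt this]
  field_simp

/-- The exponential vector of `x` in the Fock space over `ℝ^d`, the reproducing kernel Hilbert space
of the kernel `exp ⟨x, y⟩`. -/
noncomputable def fockVector {d : ℕ} (x : Eucl d) : lp (fun _ : Word d => ℝ) 2 :=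
  ⟨fun j => wordMonomial j x / √(j.1.factorial : ℝ), memℓp_fockVector x⟩

theorem fockVector_apply {d : ℕ} (x : Eucl d) (j : Word d) :
    fockVector x j = wordMonomial j x / √(j.1.factorial : ℝ) := rfl

theorem inner_fockVector {d : ℕ} (x y : Eucl d) :
    (inner ℝ (fockVector x) (fockVector y) : ℝ) = Real.exp (inner ℝ x y) := by
  refine (lp.hasSum_inner (𝕜 := ℝ) (fockVector x) (fockVector y)).unique
    ((hasSum_exp_word x y).congr_fun fun j => ?_)
  have : (0 : ℝ) ≤ (j.1.factorial : ℝ) := by positivity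
  simp only [fockVector_apply, RCLike.inner_apply, conj_trivial]
  rw [div_mul_div_comm, Real.mul_self_sqrt this]
  field_simp

theorem continuous_fockVector {d : ℕ} : Continuous (fockVector (d := d)) := by
  rw [continuous_iff_continuousAt]
  intro x
  rw [ContinuousAt, tendsto_iff_norm_sub_tendsto_zero]
  have h : ∀ y, ‖fockVector y - fockVector x‖ = √(Real.exp (inner ℝ y y)
      - 2 * Real.exp (inner ℝ y x) + Real.exp (inner ℝ x x)) := by
    intro y
    rw [← inner_fockVector, ← inner_fockVector, ← inner_fockVector, real_inner_self_eq_norm_sq,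
      real_inner_self_eq_norm_sq, ← norm_sub_sq_real, Real.sqrt_sq (norm_nonneg _)]
  simp only [h]
  have hc : Continuous fun y : Eucl d => √(Real.exp (inner ℝ y y)
      - 2 * Real.exp (inner ℝ y x) + Real.exp (inner ℝ x x)) := by fun_prop
  convert hc.tendsto x using 2
  rw [← Real.sqrt_zero]
  congr 1
  ring

theorem sum_sq_wordMonomial_le {d : ℕ} (S : Finset (Word d)) (k : Eucl d) :
    ∑ j ∈ S, (wordMonomial j k / √(j.1.factorial : ℝ)) ^ 2 ≤ Real.exp (‖k‖ ^ 2) := by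
  have h := lp.hasSum_inner (𝕜 := ℝ) (fockVector k) (fockVector k)
  rw [inner_fockVector, real_inner_self_eq_norm_sq] at h
  refine le_trans (le_of_eq ?_) (sum_le_hasSum S (fun j _ => ?_) h)
  · refine Finset.sum_congr rfl fun j _ => ?_
    simp only [fockVector_apply, RCLike.inner_apply, conj_trivial, sq]
  · exact real_inner_self_nonneg

/-- The signs in the power series of `cos + sin`. -/
theorem hasSum_cos_add_sin (t : ℝ) :
    HasSum (fun n : ℕ => (-1) ^ (n / 2) / (n.factorial : ℝ) * t ^ n) (Real.cos t + Real.sin t) := by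
  refine HasSum.even_add_odd ((Real.hasSum_cos t).congr_fun fun m => ?_)
    ((Real.hasSum_sin t).congr_fun fun m => ?_)
  · rw [Nat.mul_div_cancel_left m two_pos]
    ring
  · rw [show (2 * m + 1) / 2 = m by omega]
    ring

theorem hasSum_cos_sub_sin_sub_one (t : ℝ) :
    HasSum (fun n : ℕ => (if n = 0 then 0 else (-1) ^ (n / 2 + n) / (n.factorial : ℝ)) * t ^ n)
      (Real.cos t - Real.sin t - 1) := by
  have h : HasSum (fun n : ℕ => (-1) ^ (n / 2 + n) / (n.factorial : ℝ) * t ^ n)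
      (Real.cos t - Real.sin t) := by
    have h := hasSum_cos_add_sin (-t)
    rw [Real.cos_neg, Real.sin_neg, ← sub_eq_add_neg] at h
    refine h.congr_fun fun n => ?_
    rw [neg_pow t, pow_add]
    ring
  have h2 := h.sub (hasSum_ite_eq 0 (1 : ℝ))
  refine h2.congr_fun fun n => ?_
  split_ifs with hn
  · simp [hn]
  · simp

/-- Coefficient functions of the Hartley kernel in its Fock space expansion. -/
noncomputable def planeWaveCoeff {d : ℕ} (j : Word d) (k : Eucl d) : ℝ :=
  (-1) ^ (j.1 / 2) * (wordMonomial j k / √(j.1.factorial : ℝ))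

/-- Coefficient functions of `correctorWave` in its Fock space expansion. -/
noncomputable def correctorWaveCoeff {d : ℕ} (e : Eucl d) (j : Word d) (k : Eucl d) : ℝ :=
  if j.1 = 0 then 0 else
    correctorSymbol e k * ((-1) ^ (j.1 / 2 + j.1) * (wordMonomial j k / √(j.1.factorial : ℝ)))

theorem hasSum_planeWaveCoeff {d : ℕ} (y k : Eucl d) :
    HasSum (fun j => fockVector y j * planeWaveCoeff j k) (planeWave y k) := by
  refine (hasSum_word_of_hasSum (c := fun n => (-1) ^ (n / 2) / (n.factorial : ℝ)) (fun n => ?_)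
    k y (hasSum_cos_add_sin (inner ℝ k y))).congr_fun fun j => ?_
  · rw [abs_div, abs_pow, abs_neg, abs_one, one_pow, abs_of_nonneg (by positivity), one_div]
  · rw [fockVector_apply, planeWaveCoeff]
    have h1 : (√(j.1.factorial : ℝ)) ≠ 0 := by positivity
    have h2 : (j.1.factorial : ℝ) = √(j.1.factorial : ℝ) * √(j.1.factorial : ℝ) :=
      (Real.mul_self_sqrt (by positivity)).symm
    generalize √(j.1.factorial : ℝ) = r at *
    rw [h2]
    field_simp

theorem hasSum_correctorWaveCoeff {d : ℕ} (e y k : Eucl d) :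
    HasSum (fun j => fockVector y j * correctorWaveCoeff e j k) (correctorWave e y k) := by
  refine ((hasSum_word_of_hasSum
    (c := fun n => if n = 0 then 0 else (-1) ^ (n / 2 + n) / (n.factorial : ℝ)) (fun n => ?_)
    k y (hasSum_cos_sub_sin_sub_one (inner ℝ k y))).mul_left (correctorSymbol e k)).congr_fun
    fun j => ?_
  · split_ifs
    · simp
    · rw [abs_div, abs_pow, abs_neg, abs_one, one_pow, abs_of_nonneg (by positivity), one_div]
  · rw [fockVector_apply, correctorWaveCoeff]
    split_ifs
    · simp
    · have h1 : (√(j.1.factorial : ℝ)) ≠ 0 := by positivity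
      have h2 : (j.1.factorial : ℝ) = √(j.1.factorial : ℝ) * √(j.1.factorial : ℝ) :=
        (Real.mul_self_sqrt (by positivity)).symm
      generalize √(j.1.factorial : ℝ) = r at *
      rw [h2]
      field_simp

theorem sum_sq_planeWaveCoeff_le {d : ℕ} (S : Finset (Word d)) (k : Eucl d) :
    ∑ j ∈ S, planeWaveCoeff j k ^ 2 ≤ Real.exp (‖k‖ ^ 2) := by
  refine le_trans (le_of_eq (Finset.sum_congr rfl fun j _ => ?_)) (sum_sq_wordMonomial_le S k)
  rw [planeWaveCoeff, mul_pow, ← pow_mul, mul_comm _ 2, pow_mul]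
  simp

theorem sum_sq_correctorWaveCoeff_le {d : ℕ} {e : Eucl d} (he : ‖e‖ = 1) (S : Finset (Word d))
    (k : Eucl d) : ∑ j ∈ S, correctorWaveCoeff e j k ^ 2 ≤ Real.exp (‖k‖ ^ 2) := by
  classical
  have hterm : ∀ j : Word d, correctorWaveCoeff e j k ^ 2 = if j.1 ≠ 0 then
      correctorSymbol e k ^ 2 * (wordMonomial j k / √(j.1.factorial : ℝ)) ^ 2 else 0 := by
    intro j
    by_cases hj : j.1 = 0
    · simp [correctorWaveCoeff, hj]
    · rw [correctorWaveCoeff, if_neg hj, if_pos hj, mul_pow, mul_pow, ← pow_mul,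
        mul_comm _ 2, pow_mul]
      simp
  simp only [hterm]
  rw [← Finset.sum_filter, ← Finset.mul_sum]
  -- the empty word, which is left out, accounts for the term `1` of the exponential
  have h1 := sum_sq_wordMonomial_le
    (insert (⟨0, Fin.elim0⟩ : Word d) (S.filter fun j : Word d => j.1 ≠ 0)) k
  rw [Finset.sum_insert (by simp)] at h1
  simp only [wordMonomial, Finset.univ_eq_empty, Finset.prod_empty, Nat.factorial_zero,
    Nat.cast_one, Real.sqrt_one, div_one, one_pow] at h1
  have h2 : Real.exp (‖k‖ ^ 2) - 1 ≤ ‖k‖ ^ 2 * Real.exp (‖k‖ ^ 2) := by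
    have h3 := Real.add_one_le_exp (-(‖k‖ ^ 2))
    have h4 : Real.exp (-(‖k‖ ^ 2)) * Real.exp (‖k‖ ^ 2) = 1 := by
      rw [← Real.exp_add, neg_add_cancel, Real.exp_zero]
    nlinarith [Real.exp_pos (‖k‖ ^ 2)]
  have h5 : correctorSymbol e k ^ 2 * ‖k‖ ^ 2 ≤ 1 := by
    rw [← sq_abs, ← mul_pow]
    exact pow_le_one₀ (by positivity) (abs_correctorSymbol_mul_norm_le he k)
  calc _ ≤ correctorSymbol e k ^ 2 * (‖k‖ ^ 2 * Real.exp (‖k‖ ^ 2)) := by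
        refine mul_le_mul_of_nonneg_left ?_ (sq_nonneg _)
        simp only [wordMonomial]
        linarith
    _ = (correctorSymbol e k ^ 2 * ‖k‖ ^ 2) * Real.exp (‖k‖ ^ 2) := by ring
    _ ≤ 1 * Real.exp (‖k‖ ^ 2) := by gcongr
    _ = _ := one_mul _

/-! ### Gaussian processes indexed by a Hilbert space -/

section Isonormal

variable {Ω H : Type} [MeasurableSpace Ω] {P : Measure Ω}
  [NormedAddCommGroup H] [InnerProductSpace ℝ H] {W : H →ₗᵢ[ℝ] Lp ℝ 2 P} {ι : Type*}

theorem map_clm_map_restrict_isonormal [DecidableEq ι]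
    (hW : ∀ h, P.map (W h) = gaussianReal 0 (‖h‖₊ ^ 2))
    {h : ι → H} {Z : ι → Ω → ℝ} (hZ : ∀ i, W (h i) =ᵐ[P] Z i) (I : Finset ι)
    (L : (I → ℝ) →L[ℝ] ℝ) :
    (P.map fun s => I.restrict (Z · s)).map L =
      gaussianReal 0 (‖∑ i : I, L (fun j => if i = j then 1 else 0) • h i‖₊ ^ 2) := by
  have hm : ∀ i, AEMeasurable (Z i) P := fun i =>
    (Lp.aestronglyMeasurable (W (h i))).aemeasurable.congr (hZ i)
  have hIm : AEMeasurable (fun s => I.restrict (Z · s)) P := aemeasurable_pi_lambda _ fun i => hm i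
  rw [AEMeasurable.map_map_of_aemeasurable L.continuous.measurable.aemeasurable hIm, ← hW, map_sum]
  refine Measure.map_congr ?_
  have h1 : ∀ᵐ s ∂P, ∀ i : I, W (h i) s = Z i s := ae_all_iff.2 fun i => hZ i
  have h2 : ∀ᵐ s ∂P, ∀ i : I, (L (fun j => if i = j then 1 else 0) • W (h i) : Lp ℝ 2 P) s =
      L (fun j => if i = j then 1 else 0) * W (h i) s := by
    refine ae_all_iff.2 fun i => ?_
    filter_upwards [Lp.coeFn_smul (L (fun j => if i = j then 1 else 0)) (W (h i))] with s hs
    rw [hs, Pi.smul_apply, smul_eq_mul]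
  filter_upwards [h1, h2, Lp.coeFn_finsetSum Finset.univ fun i : I =>
    W (L (fun j => if i = j then 1 else 0) • h i)] with s h1 h2 h3
  rw [h3, Finset.sum_apply, Function.comp_apply]
  conv_lhs => rw [pi_eq_sum_univ (I.restrict fun x => Z x s), map_sum]
  refine Finset.sum_congr rfl fun i _ => ?_
  rw [map_smul, map_smul, h2, h1, smul_eq_mul, mul_comm]
  rfl

theorem isGaussianProcess_of_isonormal (hW : ∀ h, P.map (W h) = gaussianReal 0 (‖h‖₊ ^ 2))
    {h : ι → H} {Z : ι → Ω → ℝ} (hZ : ∀ i, W (h i) =ᵐ[P] Z i) : IsGaussianProcess Z P where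
  hasGaussianLaw I := by
    classical
    constructor
    refine isGaussian_of_isGaussian_map fun L => ?_
    rw [map_clm_map_restrict_isonormal hW hZ]
    infer_instance

/-- The law of a process built from an isonormal family is determined by its Gram matrices. -/
theorem identDistrib_of_isonormal [IsProbabilityMeasure P]
    (hW : ∀ h, P.map (W h) = gaussianReal 0 (‖h‖₊ ^ 2))
    {h h' : ι → H} {Z Z' : ι → Ω → ℝ} (hZ : ∀ i, W (h i) =ᵐ[P] Z i)
    (hZ' : ∀ i, W (h' i) =ᵐ[P] Z' i) (hZm : ∀ i, Measurable (Z i)) (hZm' : ∀ i, Measurable (Z' i))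
    (hgram : ∀ i j, (inner ℝ (h i) (h j) : ℝ) = inner ℝ (h' i) (h' j)) :
    IdentDistrib (fun s i => Z i s) (fun s i => Z' i s) P P := by
  classical
  refine ⟨(measurable_pi_lambda _ hZm).aemeasurable, (measurable_pi_lambda _ hZm').aemeasurable, ?_⟩
  rw [map_eq_iff_forall_finset_map_restrict_eq (measurable_pi_lambda _ hZm).aemeasurable
    (measurable_pi_lambda _ hZm').aemeasurable]
  intro I
  have := ((isGaussianProcess_of_isonormal hW hZ).hasGaussianLaw I).isGaussian_map
  have := ((isGaussianProcess_of_isonormal hW hZ').hasGaussianLaw I).isGaussian_map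
  refine Measure.ext_of_charFunDual (funext fun L => ?_)
  rw [charFunDual_eq_charFun_map_one, charFunDual_eq_charFun_map_one,
    map_clm_map_restrict_isonormal hW hZ, map_clm_map_restrict_isonormal hW hZ']
  congr 3
  have hn : ∀ x y : H, (inner ℝ x x : ℝ) = inner ℝ y y → ‖x‖₊ = ‖y‖₊ := by
    intro x y hxy
    rw [real_inner_self_eq_norm_sq, real_inner_self_eq_norm_sq] at hxy
    exact NNReal.eq (by simpa using (pow_left_inj₀ (norm_nonneg x) (norm_nonneg y) two_ne_zero).1 hxy)
  refine hn _ _ ?_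
  simp only [sum_inner, inner_sum, inner_smul_left, inner_smul_right, hgram]

theorem integral_eq_zero_of_isonormal (hW : ∀ h, P.map (W h) = gaussianReal 0 (‖h‖₊ ^ 2))
    {h : H} {Z : Ω → ℝ} (hZ : W h =ᵐ[P] Z) : ∫ s, Z s ∂P = 0 := by
  rw [← integral_congr_ae hZ]
  have := integral_map (μ := P) (φ := W h) (Lp.aestronglyMeasurable _).aemeasurable
    (f := fun x : ℝ => x) (by fun_prop)
  rw [← this, hW, integral_id_gaussianReal]

theorem integral_mul_of_isonormal {h h' : H} {Z Z' : Ω → ℝ} (hZ : W h =ᵐ[P] Z)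
    (hZ' : W h' =ᵐ[P] Z') : ∫ s, Z s * Z' s ∂P = inner ℝ h h' := by
  rw [← W.inner_map_map, L2.inner_def]
  refine integral_congr_ae ?_
  filter_upwards [hZ, hZ'] with s h1 h2
  rw [h1, h2]
  simp [mul_comm]

end Isonormal

/-! ### Gaussian fields with prescribed spectral measure -/

theorem continuous_planeWave {d : ℕ} : Continuous fun p : Eucl d × Eucl d => planeWave p.1 p.2 := by
  unfold planeWave
  fun_prop

theorem measurable_correctorWave {d : ℕ} (e : Eucl d) :
    Measurable fun p : Eucl d × Eucl d => correctorWave e p.1 p.2 := by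
  unfold correctorWave
  refine ((measurable_correctorSymbol e).comp measurable_snd).mul (Continuous.measurable ?_)
  fun_prop

theorem integral_planeWave_mul_planeWave {d : ℕ} {μ : Measure (Eucl d)} [IsFiniteMeasure μ]
    [μ.IsNegInvariant] (x y : Eucl d) :
    ∫ k, planeWave x k * planeWave y k ∂μ = ∫ k, Real.cos (inner ℝ k (x - y)) ∂μ := by
  have h : ∀ k, planeWave x k * planeWave y k =
      Real.cos (inner ℝ k (x - y)) + Real.sin (inner ℝ k (x + y)) := by
    intro k
    rw [inner_sub_right, inner_add_right, Real.cos_sub, Real.sin_add, planeWave, planeWave]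
    ring
  have hc : Integrable (fun k => Real.cos (inner ℝ k (x - y))) μ :=
    Integrable.of_bound (C := 1) (by fun_prop) (Eventually.of_forall fun k => Real.abs_cos_le_one _)
  have hs : Integrable (fun k => Real.sin (inner ℝ k (x + y))) μ :=
    Integrable.of_bound (C := 1) (by fun_prop) (Eventually.of_forall fun k => Real.abs_sin_le_one _)
  have hodd : ∫ k, Real.sin (inner ℝ k (x + y)) ∂μ = 0 := by
    have h1 := integral_neg_eq_self (fun k => Real.sin (inner ℝ k (x + y))) μ
    simp only [inner_neg_left, Real.sin_neg, integral_neg] at h1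
    linarith
  simp only [h]
  rw [integral_add hc hs, hodd, add_zero]

theorem integrable_correctorWave_sq {d : ℕ} {μ : Measure (Eucl d)} [IsFiniteMeasure μ]
    {e : Eucl d} (he : ‖e‖ = 1) (y : Eucl d) : Integrable (fun k => correctorWave e y k ^ 2) μ := by
  refine Integrable.of_bound (C := (2 * ‖y‖) ^ 2) ?_ (Eventually.of_forall fun k => ?_)
  · exact (((measurable_correctorWave e).comp measurable_prodMk_left).pow_const 2).aestronglyMeasurable
  · rw [norm_pow]
    exact pow_le_pow_left₀ (norm_nonneg _) (abs_correctorWave_le he y k) 2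

theorem continuous_laplacian_of_contDiff {d : ℕ} {ζ : Eucl d → ℝ} (hζ : ContDiff ℝ (⊤ : ℕ∞) ζ) :
    Continuous (Laplacian.laplacian ζ) := by
  rw [InnerProductSpace.laplacian_eq_iteratedFDeriv_stdOrthonormalBasis]
  refine continuous_finsetSum _ fun i _ => ?_
  have h : Continuous fun x => iteratedFDeriv ℝ 2 ζ x :=
    (contDiff_infty.1 hζ 2).continuous_iteratedFDeriv'
  exact h.eval_const _

theorem hasCompactSupport_laplacian {d : ℕ} {ζ : Eucl d → ℝ} (hζs : HasCompactSupport ζ) :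
    HasCompactSupport (Laplacian.laplacian ζ) := by
  rw [InnerProductSpace.laplacian_eq_iteratedFDeriv_stdOrthonormalBasis]
  refine (hζs.iteratedFDeriv (𝕜 := ℝ) 2).mono' fun y hy => ?_
  refine subset_tsupport _ ?_
  contrapose! hy
  simp only [Function.mem_support, not_not] at hy ⊢
  simp [hy]

/-- The scalar product with `ψ` of an average of a vector-valued function `y ↦ h_y` represented by a
bounded kernel. -/
theorem inner_clm_integral_eq {d : ℕ} {μ : Measure (Eucl d)} [IsFiniteMeasure μ]
    {K : Eucl d → Eucl d → ℝ} (hK : Measurable fun p : Eucl d × Eucl d => K p.1 p.2)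
    {b f : Eucl d → ℝ} (hKb : ∀ y k, |K y k| ≤ b y) (hb : Continuous b) (hf : Continuous f)
    (hfs : HasCompactSupport f) {T : lp (fun _ : Word d => ℝ) 2 →L[ℝ] Lp ℝ 2 μ}
    (hT : ∀ y, T (fockVector y) =ᵐ[μ] K y) (ψ : Lp ℝ 2 μ) :
    (inner ℝ ψ (T (∫ y, f y • fockVector y)) : ℝ) = ∫ k, ψ k * (∫ y, K y k * f y) ∂μ := by
  have hfi : Integrable fun y => f y • fockVector y :=
    (hf.smul continuous_fockVector).integrable_of_hasCompactSupport hfs.smul_right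
  have hψ : Integrable ψ μ := (Lp.memLp ψ).integrable (by norm_num)
  have hbf : Integrable (fun y => b y * f y) :=
    (hb.mul hf).integrable_of_hasCompactSupport hfs.mul_left
  rw [← T.integral_comp_comm hfi, ← integral_inner (T.integrable_comp hfi)]
  have h1 : ∀ y, (inner ℝ ψ (T (f y • fockVector y)) : ℝ) = ∫ k, ψ k * (K y k * f y) ∂μ := by
    intro y
    rw [map_smul, inner_smul_right, L2.inner_def, ← integral_const_mul]
    refine integral_congr_ae ?_
    filter_upwards [hT y] with k hk
    simp only [hk, RCLike.inner_apply, conj_trivial]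
    ring
  simp only [h1, ← integral_const_mul]
  refine integral_integral_swap ?_
  refine (hbf.mul_prod (μ := (volume : Measure (Eucl d))) (ν := μ) hψ).mono ?_ (Eventually.of_forall fun p => ?_)
  · exact hψ.aestronglyMeasurable.comp_snd.mul (hK.mul
      (hf.measurable.comp measurable_fst)).aestronglyMeasurable
  · simp only [Function.uncurry, norm_mul, Real.norm_eq_abs]
    calc |ψ p.2| * (|K p.1 p.2| * |f p.1|) ≤ |ψ p.2| * (|b p.1| * |f p.1|) :=
          mul_le_mul_of_nonneg_left (mul_le_mul_of_nonneg_right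
            ((hKb _ _).trans (le_abs_self _)) (abs_nonneg _)) (abs_nonneg _)
      _ = _ := by ring

/-- The spectral density of the increments of the corrector. -/
noncomputable def incrementDensity {d : ℕ} (e y k : Eucl d) : ℝ :=
  correctorSymbol e k ^ 2 * (2 * (1 - Real.cos (inner ℝ k y)))

theorem incrementDensity_nonneg {d : ℕ} (e y k : Eucl d) : 0 ≤ incrementDensity e y k :=
  mul_nonneg (sq_nonneg _) (by linarith [Real.cos_le_one (inner ℝ k y)])

theorem measurable_incrementDensity {d : ℕ} (e : Eucl d) :
    Measurable fun p : Eucl d × Eucl d => incrementDensity e p.1 p.2 := by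
  unfold incrementDensity
  refine (((measurable_correctorSymbol e).comp measurable_snd).pow_const 2).mul
    (Continuous.measurable ?_)
  fun_prop

theorem lintegral_correctorWave_sq {d : ℕ} {μ : Measure (Eucl d)} [IsFiniteMeasure μ]
    [μ.IsNegInvariant] {e : Eucl d} (he : ‖e‖ = 1) (y : Eucl d) :
    ENNReal.ofReal (∫ k, correctorWave e y k ^ 2 ∂μ) =
      ∫⁻ k, ENNReal.ofReal (incrementDensity e y k) ∂μ := by
  -- the reflection `k ↦ -k` exchanges `y` and `-y`, and cancels the odd part of the square
  have h1 : ∀ k, incrementDensity e y k =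
      (correctorWave e y k ^ 2 + correctorWave e (-y) k ^ 2) / 2 := by
    intro k
    have := Real.sin_sq_add_cos_sq (inner ℝ k y)
    rw [incrementDensity, correctorWave, correctorWave, inner_neg_right, Real.cos_neg, Real.sin_neg]
    linear_combination (-correctorSymbol e k ^ 2) * this
  have h2 : ∫ k, correctorWave e (-y) k ^ 2 ∂μ = ∫ k, correctorWave e y k ^ 2 ∂μ := by
    rw [← integral_neg_eq_self (fun k => correctorWave e y k ^ 2) μ]
    refine integral_congr_ae (Eventually.of_forall fun k => ?_)
    simp only [correctorWave, correctorSymbol, inner_neg_left, inner_neg_right, norm_neg]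
    ring
  have hi := integrable_correctorWave_sq (μ := μ) he y
  have hi' := integrable_correctorWave_sq (μ := μ) he (-y)
  rw [← ofReal_integral_eq_lintegral_ofReal _
    (Eventually.of_forall fun k => incrementDensity_nonneg e y k)]
  · simp only [h1]
    rw [integral_div, integral_add hi hi', h2, add_self_div_two]
  · exact ((hi.add hi').div_const 2).congr (Eventually.of_forall fun k => (h1 k).symm)

/-- Existence of the Gaussian field with spectral measure `μ`, together with its corrector. Both are
inner products of random elements of Fock space with the exponential vectors `fockVector x`, hence
continuous, and the linearized equation is inherited from plane waves by linearity. -/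
theorem exists_gaussianField_of_spectralMeasure {d : ℕ} {e : Eucl d} (he : ‖e‖ = 1)
    (μ : Measure (Eucl d)) [IsFiniteMeasure μ] [μ.IsNegInvariant]
    (hexp : Integrable (fun k : Eucl d => Real.exp (‖k‖ ^ 2)) μ) :
    ∃ (Ω : Type) (_ : MeasurableSpace Ω) (P : Measure Ω) (w φ : Ω → Eucl d → ℝ),
      IsProbabilityMeasure P ∧ IsCenteredStationaryGaussianField P w ∧
      (∀ x, covFun P w x = ∫ k, Real.cos (inner ℝ k x) ∂μ) ∧
      (∀ x, Measurable fun s => φ s x) ∧ (∀ s, Continuous (φ s)) ∧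
      (∀ᵐ s ∂P, SolvesLinearizedEq e (w s) (φ s)) ∧
      ∀ x, ∫⁻ s, ENNReal.ofReal (φ s x ^ 2) ∂P = ∫⁻ k, ENNReal.ofReal (incrementDensity e x k) ∂μ := by
  obtain ⟨v, hv, hvs⟩ := exists_Lp_summable_norm_sq (μ := μ) (J := Word d)
    (w := planeWaveCoeff) (fun j => ((continuous_wordMonomial j).div_const _).const_mul _ |>.measurable)
    hexp sum_sq_planeWaveCoeff_le
  obtain ⟨u, hu, hus⟩ := exists_Lp_summable_norm_sq (μ := μ) (J := Word d)
    (w := correctorWaveCoeff e) (fun j => by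
      unfold correctorWaveCoeff
      split_ifs
      · exact measurable_const
      · exact (measurable_correctorSymbol e).mul
          (((continuous_wordMonomial j).div_const _).const_mul _).measurable)
    hexp (sum_sq_correctorWaveCoeff_le he)
  obtain ⟨T, hT⟩ := exists_clm_hasSum_smul v hvs
  obtain ⟨U, hU⟩ := exists_clm_hasSum_smul u hus
  -- the Hilbert space valued functions behind the two fields
  have hTx : ∀ x, T (fockVector x) =ᵐ[μ] planeWave x := fun x =>
    ae_eq_of_hasSum_Lp (hT (fockVector x)) (w := fun j k => fockVector x j * planeWaveCoeff j k)
      (fun j => by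
        filter_upwards [Lp.coeFn_smul (fockVector x j) (v j), hv j] with k h1 h2
        rw [h1, Pi.smul_apply, h2, smul_eq_mul])
      (Eventually.of_forall fun k => hasSum_planeWaveCoeff x k)
  have hUx : ∀ x, U (fockVector x) =ᵐ[μ] correctorWave e x := fun x =>
    ae_eq_of_hasSum_Lp (hU (fockVector x))
      (w := fun j k => fockVector x j * correctorWaveCoeff e j k)
      (fun j => by
        filter_upwards [Lp.coeFn_smul (fockVector x j) (u j), hu j] with k h1 h2
        rw [h1, Pi.smul_apply, h2, smul_eq_mul])
      (Eventually.of_forall fun k => hasSum_correctorWaveCoeff e x k)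
  have hTinner : ∀ x y, (inner ℝ (T (fockVector x)) (T (fockVector y)) : ℝ) =
      ∫ k, Real.cos (inner ℝ k (x - y)) ∂μ := by
    intro x y
    rw [← integral_planeWave_mul_planeWave, L2.inner_def]
    refine integral_congr_ae ?_
    filter_upwards [hTx x, hTx y] with k h1 h2
    rw [h1, h2]
    simp [mul_comm]
  obtain ⟨Ω, mΩ, P, hP, W, hW⟩ := exists_isonormal (Lp ℝ 2 μ)
  obtain ⟨X, hXm, hX⟩ := exists_random_l2 (P := P) (fun j => W (v j)) (by simpa using hvs)
  obtain ⟨Y, hYm, hY⟩ := exists_random_l2 (P := P) (fun j => W (u j)) (by simpa using hus)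
  have hWX : ∀ a, W (T a) =ᵐ[P] fun s => (inner ℝ (X s) a : ℝ) := fun a => hX a _ (by
    simpa using (hT a).mapL W.toContinuousLinearMap)
  have hWY : ∀ a, W (U a) =ᵐ[P] fun s => (inner ℝ (Y s) a : ℝ) := fun a => hY a _ (by
    simpa using (hU a).mapL W.toContinuousLinearMap)
  let w : Ω → Eucl d → ℝ := fun s x => inner ℝ (X s) (fockVector x)
  let φ : Ω → Eucl d → ℝ := fun s x => inner ℝ (Y s) (fockVector x)
  have hwc : ∀ s, Continuous (w s) := fun s => continuous_const.inner continuous_fockVector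
  have hφc : ∀ s, Continuous (φ s) := fun s => continuous_const.inner continuous_fockVector
  have hcent : ∀ x, ∫ s, w s x ∂P = 0 := fun x =>
    integral_eq_zero_of_isonormal hW (hWX (fockVector x))
  refine ⟨Ω, mΩ, P, w, φ, hP, ⟨fun x => hXm _, hwc, ?_, hcent, fun z => ?_⟩, fun x => ?_,
    fun x => hYm _, hφc, ?_, fun x => ?_⟩
  · exact isGaussianProcess_of_isonormal hW fun x => hWX (fockVector x)
  · refine identDistrib_of_isonormal hW (Z := fun x s => w s (x + z)) (Z' := fun x s => w s x)
      (fun x => hWX (fockVector (x + z)))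
      (fun x => hWX (fockVector x)) (fun x => hXm _) (fun x => hXm _) fun x y => ?_
    rw [hTinner, hTinner, add_sub_add_right_eq_sub]
  · rw [covFun, covariance, hcent, hcent]
    simp only [sub_zero]
    rw [integral_mul_of_isonormal (hWX (fockVector x)) (hWX (fockVector 0)), hTinner, sub_zero]
  · -- for each test function, the equation is a linear relation between `X` and `Y` in Fock space
    filter_upwards [ae_forall_inner_add_inner_eq_zero (P := P) X Y] with s hs ζ hζ hζs
    have hf : Continuous fun y => fderiv ℝ ζ y e :=
      (hζ.continuous_fderiv (by simp)).clm_apply continuous_const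
    have hfs : HasCompactSupport fun y => fderiv ℝ ζ y e := hζs.fderiv_apply (𝕜 := ℝ) e
    have hl : Continuous (Laplacian.laplacian ζ) := continuous_laplacian_of_contDiff hζ
    have hls : HasCompactSupport (Laplacian.laplacian ζ) := hasCompactSupport_laplacian hζs
    have hfi : Integrable fun y => fderiv ℝ ζ y e • fockVector y :=
      (hf.smul continuous_fockVector).integrable_of_hasCompactSupport hfs.smul_right
    have hli : Integrable fun y => Laplacian.laplacian ζ y • fockVector y :=
      (hl.smul continuous_fockVector).integrable_of_hasCompactSupport hls.smul_right
    have hTU : T (∫ y, fderiv ℝ ζ y e • fockVector y) =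
        U (∫ y, Laplacian.laplacian ζ y • fockVector y) := by
      refine ext_inner_left ℝ fun ψ => ?_
      rw [inner_clm_integral_eq continuous_planeWave.measurable abs_planeWave_le continuous_const hf
          hfs hTx,
        inner_clm_integral_eq (measurable_correctorWave e) (abs_correctorWave_le he) (by fun_prop) hl
          hls hUx]
      simp only [integral_correctorWave_mul_laplacian hζ hζs]
    have hrel := hs (∫ y, fderiv ℝ ζ y e • fockVector y)
      (-∫ y, Laplacian.laplacian ζ y • fockVector y) (by
        filter_upwards [hWX (∫ y, fderiv ℝ ζ y e • fockVector y),
          hWY (∫ y, Laplacian.laplacian ζ y • fockVector y)] with s h1 h2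
        rw [inner_neg_right, ← h1, ← h2, hTU, add_neg_cancel])
    rw [inner_neg_right, ← integral_inner hfi, ← integral_inner hli, ← sub_eq_add_neg,
      sub_eq_zero] at hrel
    simp only [inner_smul_right] at hrel
    simp only [w, φ]
    rw [← integral_congr_ae (Eventually.of_forall fun y => mul_comm _ _), ← hrel]
    exact integral_congr_ae (Eventually.of_forall fun y => mul_comm _ _)
  · have hint : ∫ s, φ s x ^ 2 ∂P = ∫ k, correctorWave e x k ^ 2 ∂μ := by
      have h1 : ∫ s, φ s x ^ 2 ∂P = inner ℝ (U (fockVector x)) (U (fockVector x)) := by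
        rw [← integral_mul_of_isonormal (hWY (fockVector x)) (hWY (fockVector x))]
        simp only [φ, sq]
      rw [h1, L2.inner_def]
      refine integral_congr_ae ?_
      filter_upwards [hUx x] with k h1
      rw [h1]
      simp [sq]
    rw [← lintegral_correctorWave_sq he, ← hint, ofReal_integral_eq_lintegral_ofReal _
      (Eventually.of_forall fun s => sq_nonneg _)]
    have hL : MemLp (fun s => φ s x) 2 P := (memLp_congr_ae (hWY (fockVector x))).1 (Lp.memLp _)
    exact hL.integrable_sq

/-! ### Sublinear growth from second moments -/

/-- Integrability of `|u|²` against the weight `(1 + |x|)^{-(d + 2)}` forces sublinear growth, by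
dominated convergence. -/
theorem sublinearGrowth_of_integrable {d : ℕ} {u : Eucl d → ℝ} (hu : Continuous u)
    (hint : Integrable fun x => u x ^ 2 * ((1 + ‖x‖) ^ (d + 2))⁻¹) : SublinearGrowth u := by
  have hv : 0 < volume.real (Metric.ball (0 : Eucl d) 1) :=
    ENNReal.toReal_pos (Metric.measure_ball_pos _ _ one_pos).ne' measure_ball_lt_top.ne
  set v := volume.real (Metric.ball (0 : Eucl d) 1)
  let F : ℝ → Eucl d → ℝ := fun R => (Metric.ball 0 R).indicator fun x => u x ^ 2 / R ^ (d + 2)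
  have hF : Tendsto (fun R => ∫ x, F R x) atTop (𝓝 (∫ _ : Eucl d, (0 : ℝ))) := by
    refine tendsto_integral_filter_of_dominated_convergence
      (fun x => 2 ^ (d + 2) * (u x ^ 2 * ((1 + ‖x‖) ^ (d + 2))⁻¹)) ?_ ?_ (hint.const_mul _) ?_
    · exact Eventually.of_forall fun R => ((hu.pow 2).div_const _).aestronglyMeasurable.indicator
        measurableSet_ball
    · filter_upwards [eventually_ge_atTop 1] with R hR
      refine Eventually.of_forall fun x => ?_
      by_cases hx : x ∈ Metric.ball (0 : Eucl d) R
      · simp only [F, Set.indicator_of_mem hx]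
        rw [mem_ball_zero_iff] at hx
        have h1 : (1 + ‖x‖) ^ (d + 2) ≤ 2 ^ (d + 2) * R ^ (d + 2) := by
          rw [← mul_pow]
          exact pow_le_pow_left₀ (by positivity) (by linarith) _
        rw [Real.norm_of_nonneg (by positivity), div_le_iff₀ (by positivity)]
        have h2 : (1 : ℝ) ≤ 2 ^ (d + 2) * R ^ (d + 2) * ((1 + ‖x‖) ^ (d + 2))⁻¹ := by
          rw [← div_eq_mul_inv, one_le_div (by positivity)]
          exact h1
        calc u x ^ 2 = u x ^ 2 * 1 := (mul_one _).symm
          _ ≤ u x ^ 2 * (2 ^ (d + 2) * R ^ (d + 2) * ((1 + ‖x‖) ^ (d + 2))⁻¹) := by gcongr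
          _ = _ := by ring
      · simp only [F, Set.indicator_of_notMem hx, norm_zero]
        positivity
    · refine Eventually.of_forall fun x => ?_
      refine squeeze_zero_norm' (a := fun R : ℝ => u x ^ 2 / R ^ (d + 2)) ?_
        (tendsto_const_nhds.div_atTop (tendsto_pow_atTop (by omega)))
      filter_upwards [eventually_gt_atTop 0] with R hR
      refine (norm_indicator_le_norm_self _ _).trans (le_of_eq ?_)
      exact Real.norm_of_nonneg (by positivity)
  rw [integral_zero] at hF
  have h2 := hF.const_mul v⁻¹
  rw [mul_zero] at h2
  refine h2.congr' ?_
  filter_upwards [eventually_gt_atTop 0] with R hR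
  have hvol : volume.real (Metric.ball (0 : Eucl d) R) = R ^ d * v := by
    rw [Measure.real, Measure.addHaar_ball_of_pos volume _ hR, ENNReal.toReal_mul,
      ENNReal.toReal_ofReal (by positivity), finrank_euclideanSpace_fin]
    rfl
  rw [setAverage_eq, hvol, smul_eq_mul, integral_indicator measurableSet_ball, integral_div,
    integral_div]
  simp only [sq_abs]
  field_simp
  ring

/-- A random field whose second moments grow at most like `|x|^{2 - ε}` grows sublinearly. -/
theorem ae_sublinearGrowth_of_lintegral_sq_le {d : ℕ} {Ω : Type} [MeasurableSpace Ω]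
    {P : Measure Ω} [IsProbabilityMeasure P] {φ : Ω → Eucl d → ℝ}
    (hm : ∀ x, Measurable fun s => φ s x) (hc : ∀ s, Continuous (φ s)) {A ε : ℝ} (hε : 0 < ε)
    (hε2 : ε ≤ 2) (hA : 0 ≤ A)
    (hmom : ∀ x, ∫⁻ s, ENNReal.ofReal (φ s x ^ 2) ∂P ≤ ENNReal.ofReal (A * ‖x‖ ^ (2 - ε))) :
    ∀ᵐ s ∂P, SublinearGrowth (φ s) := by
  have hjoint : Measurable (Function.uncurry fun (x : Eucl d) (s : Ω) => φ s x) :=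
    measurable_uncurry_of_continuous_of_measurable (u := fun (x : Eucl d) (s : Ω) => φ s x) hc hm
  let k : Eucl d → ℝ := fun x => ((1 + ‖x‖) ^ (d + 2))⁻¹
  have hk : Continuous k := by
    refine Continuous.inv₀ (by fun_prop) fun x => ?_
    positivity
  have hk0 : ∀ x, 0 ≤ k x := fun x => by positivity
  have hjm : Measurable (Function.uncurry fun (x : Eucl d) (s : Ω) =>
      ENNReal.ofReal (φ s x ^ 2 * k x)) :=
    ((hjoint.pow_const 2).mul (hk.measurable.comp measurable_fst)).ennreal_ofReal
  have hfin : ∫⁻ s, (∫⁻ x, ENNReal.ofReal (φ s x ^ 2 * k x)) ∂P ≠ ⊤ := by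
    rw [← lintegral_lintegral_swap hjm.aemeasurable]
    have hJ : Integrable fun x : Eucl d => A * (1 + ‖x‖) ^ (-(d + ε)) :=
      (integrable_one_add_norm (by rw [finrank_euclideanSpace_fin]; linarith)).const_mul A
    refine ne_top_of_le_ne_top hJ.lintegral_lt_top.ne (lintegral_mono fun x => ?_)
    have hpos : (0 : ℝ) < 1 + ‖x‖ := by positivity
    calc ∫⁻ s, ENNReal.ofReal (φ s x ^ 2 * k x) ∂P
        = (∫⁻ s, ENNReal.ofReal (φ s x ^ 2) ∂P) * ENNReal.ofReal (k x) := by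
          rw [← lintegral_mul_const _ ((hm x).pow_const 2).ennreal_ofReal]
          exact lintegral_congr fun s => ENNReal.ofReal_mul (sq_nonneg _)
      _ ≤ ENNReal.ofReal (A * ‖x‖ ^ (2 - ε)) * ENNReal.ofReal (k x) := by gcongr; exact hmom x
      _ = ENNReal.ofReal (A * ‖x‖ ^ (2 - ε) * k x) := (ENNReal.ofReal_mul (by positivity)).symm
      _ ≤ ENNReal.ofReal (A * (1 + ‖x‖) ^ (-(d + ε))) := by
          refine ENNReal.ofReal_le_ofReal ?_
          have h1 : (1 + ‖x‖) ^ (-(d + ε)) = (1 + ‖x‖) ^ (2 - ε) * k x := by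
            simp only [k]
            rw [← Real.rpow_natCast, ← Real.rpow_neg hpos.le, ← Real.rpow_add hpos]
            congr 1
            push_cast
            ring
          rw [h1, mul_assoc]
          gcongr
          linarith
  have hswap : Measurable fun s => ∫⁻ x : Eucl d, ENNReal.ofReal (φ s x ^ 2 * k x) :=
    Measurable.lintegral_prod_left' hjm
  filter_upwards [ae_lt_top hswap hfin] with s hs
  refine sublinearGrowth_of_integrable (hc s) ⟨?_, ?_⟩
  · exact (((hc s).pow 2).mul hk).aestronglyMeasurable
  · rw [hasFiniteIntegral_iff_ofReal (Eventually.of_forall fun x => mul_nonneg (sq_nonneg _) (hk0 x))]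
    exact hs

theorem two_mul_one_sub_cos_le {t ε : ℝ} (hε : 0 ≤ ε) (hε2 : ε ≤ 2) :
    2 * (1 - Real.cos t) ≤ 4 * |t| ^ (2 - ε) := by
  rcases le_or_gt |t| 1 with h | h
  · have h1 := Real.one_sub_sq_div_two_le_cos (x := t)
    have h2 : |t| ^ (2 : ℝ) ≤ |t| ^ (2 - ε) := by
      rcases (abs_nonneg t).eq_or_lt with h0 | h0
      · rw [← h0, Real.zero_rpow two_ne_zero]
        exact Real.rpow_nonneg le_rfl _
      · exact Real.rpow_le_rpow_of_exponent_ge h0 h (by linarith)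
    rw [Real.rpow_two, sq_abs] at h2
    nlinarith [Real.rpow_nonneg (abs_nonneg t) (2 - ε)]
  · have h1 := Real.neg_one_le_cos t
    have h2 : 1 ≤ |t| ^ (2 - ε) := Real.one_le_rpow h.le (by linarith)
    linarith

theorem incrementDensity_le {d : ℕ} {e : Eucl d} (he : ‖e‖ = 1) {ε : ℝ} (hε : 0 ≤ ε) (hε2 : ε ≤ 2)
    (x k : Eucl d) : incrementDensity e x k ≤ 4 * ‖x‖ ^ (2 - ε) * ‖k‖ ^ (-ε) := by
  rcases eq_or_ne k 0 with rfl | hk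
  · simp only [incrementDensity, inner_zero_left, Real.cos_zero, sub_self, mul_zero]
    positivity
  have hk' : 0 < ‖k‖ := norm_pos_iff.2 hk
  have h1 : 2 * (1 - Real.cos (inner ℝ k x)) ≤ 4 * (‖k‖ * ‖x‖) ^ (2 - ε) := by
    refine (two_mul_one_sub_cos_le hε hε2).trans ?_
    have := Real.rpow_le_rpow (abs_nonneg _) (abs_real_inner_le_norm k x)
      (by linarith : 0 ≤ 2 - ε)
    linarith
  have h2 : correctorSymbol e k ^ 2 ≤ (‖k‖ ^ 2)⁻¹ := by
    rw [← one_div, le_div_iff₀ (by positivity), ← sq_abs, ← mul_pow]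
    exact pow_le_one₀ (by positivity) (abs_correctorSymbol_mul_norm_le he k)
  calc incrementDensity e x k ≤ (‖k‖ ^ 2)⁻¹ * (4 * (‖k‖ * ‖x‖) ^ (2 - ε)) :=
        mul_le_mul h2 h1 (by linarith [Real.cos_le_one (inner ℝ k x)]) (by positivity)
    _ = _ := by
        rw [Real.mul_rpow hk'.le (norm_nonneg x), Real.rpow_sub hk', Real.rpow_two, Real.rpow_neg hk'.le]
        field_simp

/-! ### Gaussian integrals in frequency space -/

theorem integrable_exp_neg_mul_norm_sq {d : ℕ} {b : ℝ} (hb : 0 < b) :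
    Integrable fun p : Eucl d => Real.exp (-b * ‖p‖ ^ 2) := by
  have h := GaussianFourier.integrable_cexp_neg_mul_sq_norm_add (V := Eucl d) (b := (b : ℂ))
    (by simpa using hb) 0 0
  refine h.norm.congr (Eventually.of_forall fun p => ?_)
  simp only [zero_mul, add_zero, Complex.norm_exp]
  norm_cast

theorem integrable_cos_mul_exp_neg_mul_norm_sq {d : ℕ} {b : ℝ} (hb : 0 < b) (x : Eucl d) :
    Integrable fun p : Eucl d => Real.cos (inner ℝ p x) * Real.exp (-b * ‖p‖ ^ 2) := by
  refine (integrable_exp_neg_mul_norm_sq hb).bdd_mul (c := 1) (by fun_prop) ?_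
  exact Eventually.of_forall fun p => by simpa using Real.abs_cos_le_one _

theorem integral_cos_mul_exp_neg_mul_norm_sq {d : ℕ} {b : ℝ} (hb : 0 < b) (x : Eucl d) :
    ∫ p : Eucl d, Real.cos (inner ℝ p x) * Real.exp (-b * ‖p‖ ^ 2) =
      (Real.pi / b) ^ ((d : ℝ) / 2) * Real.exp (-(‖x‖ ^ 2 / (4 * b))) := by
  have h := GaussianFourier.integral_cexp_neg_mul_sq_norm_add (V := Eucl d) (b := (b : ℂ))
    (by simpa using hb) Complex.I x
  have hi := GaussianFourier.integrable_cexp_neg_mul_sq_norm_add (V := Eucl d) (b := (b : ℂ))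
    (by simpa using hb) Complex.I x
  have h3 : ∀ p : Eucl d, (Complex.exp (-b * ‖p‖ ^ 2 + Complex.I * (inner ℝ x p : ℝ))).re =
      Real.cos (inner ℝ p x) * Real.exp (-b * ‖p‖ ^ 2) := by
    intro p
    rw [Complex.exp_re]
    have e1 : (-(b : ℂ) * ‖p‖ ^ 2 + Complex.I * (inner ℝ x p : ℝ)).re = -b * ‖p‖ ^ 2 := by
      simp [← Complex.ofReal_pow]
    have e2 : (-(b : ℂ) * ‖p‖ ^ 2 + Complex.I * (inner ℝ x p : ℝ)).im = inner ℝ x p := by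
      simp [← Complex.ofReal_pow]
    rw [e1, e2, mul_comm, real_inner_comm]
  have h4 := Complex.reCLM.integral_comp_comm hi
  simp only [Complex.reCLM_apply, h3] at h4
  have h5 : ((Real.pi : ℂ) / b) ^ ((Module.finrank ℝ (Eucl d) : ℂ) / 2) *
      Complex.exp (Complex.I ^ 2 * ‖x‖ ^ 2 / (4 * b)) =
      (((Real.pi / b) ^ ((d : ℝ) / 2) * Real.exp (-(‖x‖ ^ 2 / (4 * b))) : ℝ) : ℂ) := by
    rw [finrank_euclideanSpace_fin, Complex.I_sq, Complex.ofReal_mul, Complex.ofReal_exp,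
      Complex.ofReal_cpow (by positivity)]
    congr 1
    · push_cast; rfl
    · congr 1; push_cast; ring
  rw [h4, h, h5, Complex.ofReal_re]

/-- The product of the two increments integrates to at least the product of the integrals: after
expansion the cross terms contribute a hyperbolic cosine, which is at least `1`. -/
theorem le_integral_one_sub_cos_mul_one_sub_cos {d : ℕ} {b : ℝ} (hb : 0 < b) (e x : Eucl d) :
    Integrable (fun p : Eucl d => (1 - Real.cos (inner ℝ p e)) * (1 - Real.cos (inner ℝ p x)) *
      Real.exp (-b * ‖p‖ ^ 2)) ∧
    (Real.pi / b) ^ ((d : ℝ) / 2) * (1 - Real.exp (-(‖e‖ ^ 2 / (4 * b)))) *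
      (1 - Real.exp (-(‖x‖ ^ 2 / (4 * b)))) ≤
    ∫ p : Eucl d, (1 - Real.cos (inner ℝ p e)) * (1 - Real.cos (inner ℝ p x)) *
      Real.exp (-b * ‖p‖ ^ 2) := by
  have hg := fun z : Eucl d => integrable_cos_mul_exp_neg_mul_norm_sq hb z
  have hI := fun z : Eucl d => integral_cos_mul_exp_neg_mul_norm_sq hb z
  set g : Eucl d → Eucl d → ℝ := fun z p => Real.cos (inner ℝ p z) * Real.exp (-b * ‖p‖ ^ 2)
  have hexp : (fun p : Eucl d => (1 - Real.cos (inner ℝ p e)) * (1 - Real.cos (inner ℝ p x)) *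
      Real.exp (-b * ‖p‖ ^ 2)) =
      fun p => g 0 p - g e p - g x p + (2⁻¹ * g (x - e) p + 2⁻¹ * g (x + e) p) := by
    funext p
    simp only [g, inner_zero_right, Real.cos_zero, inner_sub_right, inner_add_right, Real.cos_sub,
      Real.cos_add]
    ring
  have i1 := ((hg 0).sub (hg e)).sub (hg x)
  have i2 := ((hg (x - e)).const_mul 2⁻¹).add ((hg (x + e)).const_mul 2⁻¹)
  refine ⟨hexp ▸ i1.add i2, ?_⟩
  have hval : ∫ p, (g 0 p - g e p - g x p + (2⁻¹ * g (x - e) p + 2⁻¹ * g (x + e) p)) =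
      (∫ p, g 0 p) - (∫ p, g e p) - (∫ p, g x p) +
        (2⁻¹ * (∫ p, g (x - e) p) + 2⁻¹ * ∫ p, g (x + e) p) := by
    have a1 := integral_add i1 i2
    have a2 := integral_sub ((hg 0).sub (hg e)) (hg x)
    have a3 := integral_sub (hg 0) (hg e)
    have a4 := integral_add ((hg (x - e)).const_mul 2⁻¹) ((hg (x + e)).const_mul 2⁻¹)
    simp only [Pi.sub_apply, Pi.add_apply, integral_const_mul] at a1 a2 a3 a4
    rw [a1, a2, a3, a4]
  rw [hexp, hval]
  simp only [g, hI]
  have hm : ‖x - e‖ ^ 2 = ‖x‖ ^ 2 + ‖e‖ ^ 2 - 2 * inner ℝ x e := by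
    rw [norm_sub_sq_real]; ring
  have hp : ‖x + e‖ ^ 2 = ‖x‖ ^ 2 + ‖e‖ ^ 2 + 2 * inner ℝ x e := by
    rw [norm_add_sq_real]; ring
  have hm' : Real.exp (-(‖x - e‖ ^ 2 / (4 * b))) = Real.exp (-(‖x‖ ^ 2 / (4 * b))) *
      Real.exp (-(‖e‖ ^ 2 / (4 * b))) * Real.exp (inner ℝ x e / (2 * b)) := by
    rw [← Real.exp_add, ← Real.exp_add, hm]; congr 1; field_simp; ring
  have hp' : Real.exp (-(‖x + e‖ ^ 2 / (4 * b))) = Real.exp (-(‖x‖ ^ 2 / (4 * b))) *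
      Real.exp (-(‖e‖ ^ 2 / (4 * b))) * Real.exp (-(inner ℝ x e / (2 * b))) := by
    rw [← Real.exp_add, ← Real.exp_add, hp]; congr 1; field_simp; ring
  rw [hm', hp', norm_zero]
  have hG : 0 ≤ (Real.pi / b) ^ ((d : ℝ) / 2) := by positivity
  have hX := Real.exp_pos (-(‖x‖ ^ 2 / (4 * b)))
  have hE := Real.exp_pos (-(‖e‖ ^ 2 / (4 * b)))
  have hcosh : 2 ≤ Real.exp (inner ℝ x e / (2 * b)) + Real.exp (-(inner ℝ x e / (2 * b))) := by
    have h1 := Real.add_one_le_exp (inner ℝ x e / (2 * b))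
    have h2 := Real.add_one_le_exp (-(inner ℝ x e / (2 * b)))
    linarith
  have key := mul_le_mul_of_nonneg_left hcosh
    (mul_nonneg hG (mul_nonneg hX.le hE.le))
  simp only [ne_eq, OfNat.ofNat_ne_zero, not_false_eq_true, zero_pow, zero_div, neg_zero,
    Real.exp_zero]
  nlinarith [key]

/-! ### Dyadic superposition of Gaussians -/

theorem sq_mul_exp_neg_le {z : ℝ} (hz : 0 ≤ z) :
    z ^ 2 * Real.exp (-z) ≤ 12 * ((1 + z)⁻¹ - (1 + 4 * z)⁻¹) := by
  have h1 := Real.pow_div_factorial_le_exp z hz 1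
  have h2 := Real.pow_div_factorial_le_exp z hz 2
  have h3 := Real.pow_div_factorial_le_exp z hz 3
  norm_num [Nat.factorial] at h1 h2 h3
  have h : (1 + z)⁻¹ - (1 + 4 * z)⁻¹ = 3 * z / ((1 + z) * (1 + 4 * z)) := by
    field_simp; ring
  rw [h, Real.exp_neg, ← div_eq_mul_inv, ← mul_div_assoc, div_le_div_iff₀ (Real.exp_pos z)
    (by positivity)]
  have h4 : z * (1 + z) * (1 + 4 * z) ≤ 36 * Real.exp z := by nlinarith [Real.exp_pos z]
  nlinarith [mul_le_mul_of_nonneg_left h4 hz]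

/-- Geometric sums of Gaussians in the variable `y = ‖p‖²` are dominated by the homogeneous
function `y⁻²`. -/
theorem sum_pow_mul_exp_neg_le {y : ℝ} (hy : 0 ≤ y) (M : ℕ) :
    y ^ 2 * ∑ m ∈ Finset.range M, 16 ^ m * Real.exp (-(4 ^ m * y)) ≤ 12 := by
  suffices h : y ^ 2 * ∑ m ∈ Finset.range M, 16 ^ m * Real.exp (-(4 ^ m * y)) ≤
      12 * (1 - (1 + 4 ^ M * y)⁻¹) by
    have : 0 ≤ (1 + 4 ^ M * y)⁻¹ := by positivity
    linarith
  induction M with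
  | zero =>
    have : (1 + y)⁻¹ ≤ 1 := inv_le_one_of_one_le₀ (by linarith)
    simpa using this
  | succ M ih =>
    have h := sq_mul_exp_neg_le (z := 4 ^ M * y) (by positivity)
    have e16 : (16 : ℝ) ^ M = (4 ^ M) ^ 2 := by rw [← pow_mul, mul_comm, pow_mul]; norm_num
    rw [Finset.sum_range_succ, mul_add, pow_succ (4 : ℝ) M, e16,
      show (1 : ℝ) + 4 ^ M * 4 * y = 1 + 4 * (4 ^ M * y) by ring]
    nlinarith [h, ih]

theorem half_le_one_sub_exp_neg {u : ℝ} (hu : 0 ≤ u) (hu1 : u ≤ 1) :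
    u / 2 ≤ 1 - Real.exp (-u) := by
  have h1 : 1 + u ≤ Real.exp u := by linarith [Real.add_one_le_exp u]
  rw [Real.exp_neg]
  have h2 : (Real.exp u)⁻¹ ≤ (1 + u)⁻¹ := inv_anti₀ (by linarith) h1
  have h3 : (1 + u)⁻¹ ≤ 1 - u / 2 := by
    rw [inv_le_iff_one_le_mul₀ (by linarith)]
    nlinarith
  linarith

/-- The pointwise lower bound of the corrector spectrum by a finite superposition of Gaussians with
explicit integrals. -/
theorem sum_le_incrementDensity_mul_exp {d : ℕ} (e x p : Eucl d) (M : ℕ) :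
    ∑ m ∈ Finset.range M, (3 : ℝ)⁻¹ * 16 ^ m * ((1 - Real.cos (inner ℝ p e)) *
      (1 - Real.cos (inner ℝ p x)) * Real.exp (-(4 ^ m + 2) * ‖p‖ ^ 2)) ≤
    Real.exp (-2 * ‖p‖ ^ 2) * incrementDensity e x p := by
  rcases eq_or_ne p 0 with rfl | hp
  · simp [incrementDensity]
  have hy : 0 < ‖p‖ ^ 2 := by positivity
  set y := ‖p‖ ^ 2 with hydef
  have hS := sum_pow_mul_exp_neg_le hy.le M
  set S := ∑ m ∈ Finset.range M, 16 ^ m * Real.exp (-(4 ^ m * y)) with hSdef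
  have hS0 : 0 ≤ S := Finset.sum_nonneg fun m _ => by positivity
  have hce : 0 ≤ 1 - Real.cos (inner ℝ p e) := by linarith [Real.cos_le_one (inner ℝ p e)]
  have hcx : 0 ≤ 1 - Real.cos (inner ℝ p x) := by linarith [Real.cos_le_one (inner ℝ p x)]
  have hq : 2 * (1 - Real.cos (inner ℝ p e)) ≤ inner ℝ p e ^ 2 := by
    linarith [Real.one_sub_sq_div_two_le_cos (x := inner ℝ p e)]
  have hsum : ∑ m ∈ Finset.range M, (3 : ℝ)⁻¹ * 16 ^ m * ((1 - Real.cos (inner ℝ p e)) *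
      (1 - Real.cos (inner ℝ p x)) * Real.exp (-(4 ^ m + 2) * y)) =
      3⁻¹ * (1 - Real.cos (inner ℝ p e)) * (1 - Real.cos (inner ℝ p x)) * Real.exp (-2 * y) * S := by
    rw [hSdef, Finset.mul_sum]
    refine Finset.sum_congr rfl fun m _ => ?_
    rw [show -((4 : ℝ) ^ m + 2) * y = -2 * y + -(4 ^ m * y) by ring, Real.exp_add]
    ring
  rw [hsum]
  have hD : incrementDensity e x p =
      inner ℝ p e ^ 2 * (2 * (1 - Real.cos (inner ℝ p x))) / y ^ 2 := by
    rw [incrementDensity, correctorSymbol, real_inner_comm p e]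
    ring
  rw [hD, ← mul_div_assoc, le_div_iff₀ (by positivity)]
  have hE := Real.exp_pos (-2 * y)
  calc 3⁻¹ * (1 - Real.cos (inner ℝ p e)) * (1 - Real.cos (inner ℝ p x)) * Real.exp (-2 * y) * S *
        y ^ 2
      = 3⁻¹ * (1 - Real.cos (inner ℝ p e)) * (1 - Real.cos (inner ℝ p x)) * Real.exp (-2 * y) *
        (y ^ 2 * S) := by ring
    _ ≤ 3⁻¹ * (1 - Real.cos (inner ℝ p e)) * (1 - Real.cos (inner ℝ p x)) * Real.exp (-2 * y) * 12 :=
        mul_le_mul_of_nonneg_left hS (by positivity)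
    _ = Real.exp (-2 * y) * (2 * (1 - Real.cos (inner ℝ p x))) *
        (2 * (1 - Real.cos (inner ℝ p e))) := by ring
    _ ≤ Real.exp (-2 * y) * (2 * (1 - Real.cos (inner ℝ p x))) * inner ℝ p e ^ 2 :=
        mul_le_mul_of_nonneg_left hq (by positivity)
    _ = _ := by ring

theorem le_integral_gaussian_term {d : ℕ} {e x : Eucl d} (he : ‖e‖ = 1) {m : ℕ}
    (hx : 2 ^ m ≤ ‖x‖) :
    1728⁻¹ * (4 / 2 ^ d : ℝ) ^ m ≤
    ∫ p : Eucl d, (3 : ℝ)⁻¹ * 16 ^ m * ((1 - Real.cos (inner ℝ p e)) *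
      (1 - Real.cos (inner ℝ p x)) * Real.exp (-(4 ^ m + 2) * ‖p‖ ^ 2)) := by
  have h4 : (1 : ℝ) ≤ 4 ^ m := one_le_pow₀ (by norm_num)
  have h22 : ((2 : ℝ) ^ m) ^ 2 = 4 ^ m := by rw [← pow_mul, mul_comm, pow_mul]; norm_num
  have h := (le_integral_one_sub_cos_mul_one_sub_cos (b := 4 ^ m + 2) (by positivity) e x).2
  rw [integral_const_mul]
  refine le_trans ?_ (mul_le_mul_of_nonneg_left h (by positivity))
  have h1 : ((2 ^ d)⁻¹ : ℝ) ^ m ≤ (Real.pi / (4 ^ m + 2)) ^ ((d : ℝ) / 2) := by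
    have hle : (4 ^ m : ℝ)⁻¹ ≤ Real.pi / (4 ^ m + 2) := by
      rw [le_div_iff₀ (by positivity), inv_mul_le_iff₀ (by positivity)]
      nlinarith [Real.pi_gt_three]
    calc ((2 ^ d)⁻¹ : ℝ) ^ m = ((4 ^ m : ℝ)⁻¹) ^ ((d : ℝ) / 2) := by
          rw [show (4 ^ m : ℝ)⁻¹ = (((2 : ℝ) ^ m)⁻¹) ^ 2 by rw [inv_pow, h22],
            ← Real.rpow_natCast (((2 : ℝ) ^ m)⁻¹) 2,
            ← Real.rpow_mul (by positivity), show ((2 : ℕ) : ℝ) * ((d : ℝ) / 2) = d by push_cast; ring,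
            Real.rpow_natCast, inv_pow, inv_pow, ← pow_mul, ← pow_mul, mul_comm]
      _ ≤ _ := Real.rpow_le_rpow (by positivity) hle (by positivity)
  have h2 : (24 * 4 ^ m : ℝ)⁻¹ ≤ 1 - Real.exp (-(‖e‖ ^ 2 / (4 * (4 ^ m + 2)))) := by
    have hu : (12 * 4 ^ m : ℝ)⁻¹ ≤ ‖e‖ ^ 2 / (4 * (4 ^ m + 2)) := by
      rw [he, one_pow, one_div]
      exact inv_anti₀ (by positivity) (by linarith)
    have h3 := half_le_one_sub_exp_neg (u := (12 * 4 ^ m : ℝ)⁻¹) (by positivity)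
      (inv_le_one_of_one_le₀ (by linarith))
    have h4 := Real.exp_le_exp.2 (neg_le_neg hu)
    have h5 : (24 * 4 ^ m : ℝ)⁻¹ = (12 * 4 ^ m : ℝ)⁻¹ / 2 := by field_simp; norm_num
    linarith
  have h3 : (24 : ℝ)⁻¹ ≤ 1 - Real.exp (-(‖x‖ ^ 2 / (4 * (4 ^ m + 2)))) := by
    have hu : (12 : ℝ)⁻¹ ≤ ‖x‖ ^ 2 / (4 * (4 ^ m + 2)) := by
      rw [le_div_iff₀ (by positivity)]
      have := pow_le_pow_left₀ (by positivity) hx 2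
      rw [h22] at this
      linarith
    have h3 := half_le_one_sub_exp_neg (u := (12 : ℝ)⁻¹) (by positivity) (by norm_num)
    have h4 := Real.exp_le_exp.2 (neg_le_neg hu)
    linarith
  have e16 : (16 : ℝ) ^ m = 4 ^ m * 4 ^ m := by rw [← mul_pow]; norm_num
  calc 1728⁻¹ * (4 / 2 ^ d : ℝ) ^ m
      = 3⁻¹ * 16 ^ m * (((2 ^ d)⁻¹ : ℝ) ^ m * (24 * 4 ^ m : ℝ)⁻¹ * (24 : ℝ)⁻¹) := by
        rw [div_eq_mul_inv, mul_pow, e16]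
        field_simp
        norm_num
    _ ≤ _ := mul_le_mul_of_nonneg_left (mul_le_mul (mul_le_mul h1 h2 (by positivity)
        (by positivity)) h3 (by positivity) (mul_nonneg (by positivity)
          (le_trans (by positivity) h2))) (by positivity)

/-- The Gaussian weight `e^{-2‖p‖²}` as a measure on frequency space. -/
noncomputable def gaussianWeight (d : ℕ) : Measure (Eucl d) :=
  volume.withDensity fun p => ENNReal.ofReal (Real.exp (-2 * ‖p‖ ^ 2))

theorem lintegral_gaussianWeight {d : ℕ} {f : Eucl d → ℝ} (hf : Measurable f) :
    ∫⁻ p, ENNReal.ofReal (f p) ∂gaussianWeight d =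
      ∫⁻ p, ENNReal.ofReal (Real.exp (-2 * ‖p‖ ^ 2) * f p) := by
  rw [gaussianWeight, lintegral_withDensity_eq_lintegral_mul _ (by fun_prop) hf.ennreal_ofReal]
  exact lintegral_congr fun p => (ENNReal.ofReal_mul (Real.exp_pos _).le).symm

/-- Second moments of the corrector increments for the spectral measure `gaussianWeight`: each
dyadic frequency scale `2^{-m}` with `2^m ≤ ‖x‖` contributes `(4 / 2^d)^m`. -/
theorem sum_le_lintegral_incrementDensity_gaussianWeight {d : ℕ} {e x : Eucl d} (he : ‖e‖ = 1)
    {M : ℕ} (hx : ∀ m < M, 2 ^ m ≤ ‖x‖) :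
    ENNReal.ofReal (1728⁻¹ * ∑ m ∈ Finset.range M, (4 / 2 ^ d : ℝ) ^ m) ≤
      ∫⁻ p, ENNReal.ofReal (incrementDensity e x p) ∂gaussianWeight d := by
  have hmeas : Measurable fun p => incrementDensity e x p :=
    Measurable.of_uncurry_left (f := incrementDensity e) (measurable_incrementDensity e)
  rw [lintegral_gaussianWeight hmeas]
  have hint : ∀ m ∈ Finset.range M, Integrable fun p : Eucl d =>
      (3 : ℝ)⁻¹ * 16 ^ m * ((1 - Real.cos (inner ℝ p e)) *
        (1 - Real.cos (inner ℝ p x)) * Real.exp (-(4 ^ m + 2) * ‖p‖ ^ 2)) := by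
    intro m _
    have hb : (0 : ℝ) < 4 ^ m + 2 := by positivity
    exact (le_integral_one_sub_cos_mul_one_sub_cos hb e x).1.const_mul (3⁻¹ * 16 ^ m)
  have hnn : ∀ p : Eucl d, 0 ≤ ∑ m ∈ Finset.range M, (3 : ℝ)⁻¹ * 16 ^ m *
      ((1 - Real.cos (inner ℝ p e)) * (1 - Real.cos (inner ℝ p x)) *
        Real.exp (-(4 ^ m + 2) * ‖p‖ ^ 2)) := fun p => Finset.sum_nonneg fun m _ => by
    have hce : 0 ≤ 1 - Real.cos (inner ℝ p e) := by linarith [Real.cos_le_one (inner ℝ p e)]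
    have hcx : 0 ≤ 1 - Real.cos (inner ℝ p x) := by linarith [Real.cos_le_one (inner ℝ p x)]
    positivity
  calc ENNReal.ofReal (1728⁻¹ * ∑ m ∈ Finset.range M, (4 / 2 ^ d : ℝ) ^ m)
      ≤ ENNReal.ofReal (∫ p, ∑ m ∈ Finset.range M, (3 : ℝ)⁻¹ * 16 ^ m *
          ((1 - Real.cos (inner ℝ p e)) * (1 - Real.cos (inner ℝ p x)) *
            Real.exp (-(4 ^ m + 2) * ‖p‖ ^ 2))) := by
        refine ENNReal.ofReal_le_ofReal ?_
        rw [integral_finsetSum _ hint, Finset.mul_sum]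
        exact Finset.sum_le_sum fun m hm => le_integral_gaussian_term he (hx m (Finset.mem_range.1 hm))
    _ = ∫⁻ p, ENNReal.ofReal (∑ m ∈ Finset.range M, (3 : ℝ)⁻¹ * 16 ^ m *
          ((1 - Real.cos (inner ℝ p e)) * (1 - Real.cos (inner ℝ p x)) *
            Real.exp (-(4 ^ m + 2) * ‖p‖ ^ 2))) :=
        ofReal_integral_eq_lintegral_ofReal (integrable_finsetSum _ hint) (Eventually.of_forall hnn)
    _ ≤ _ := lintegral_mono fun p =>
        ENNReal.ofReal_le_ofReal (sum_le_incrementDensity_mul_exp e x p M)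

/-! ### The multiscale spectral measure -/

theorem lintegral_gaussianWeight_ennreal {d : ℕ} {f : Eucl d → ENNReal} (hf : Measurable f) :
    ∫⁻ p, f p ∂gaussianWeight d = ∫⁻ p, ENNReal.ofReal (Real.exp (-2 * ‖p‖ ^ 2)) * f p := by
  rw [gaussianWeight, lintegral_withDensity_eq_lintegral_mul _ (by fun_prop) hf]
  rfl

/-- The spectral measure of the field: the sum over `n` of the Gaussian weight rescaled to
frequencies of order `2^{-n}`, with total masses proportional to `b^n`. With `b = 2^{-β}` its
density behaves like `|k|^{β - d}` near the origin. -/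
noncomputable def multiscaleMeasure (d : ℕ) (κ b : ℝ) : Measure (Eucl d) :=
  Measure.sum fun n : ℕ =>
    ENNReal.ofReal (κ * b ^ n) • (gaussianWeight d).map fun p => ((2 : ℝ) ^ n)⁻¹ • p

theorem lintegral_multiscaleMeasure {d : ℕ} {κ b : ℝ} {f : Eucl d → ENNReal} (hf : Measurable f) :
    ∫⁻ k, f k ∂multiscaleMeasure d κ b =
      ∑' n : ℕ, ENNReal.ofReal (κ * b ^ n) *
        ∫⁻ p, f (((2 : ℝ) ^ n)⁻¹ • p) ∂gaussianWeight d := by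
  rw [multiscaleMeasure, lintegral_sum_measure]
  refine tsum_congr fun n => ?_
  rw [lintegral_smul_measure, lintegral_map hf (by fun_prop), smul_eq_mul]

theorem lintegral_multiscaleMeasure_lt_top {d : ℕ} {κ b A : ℝ} (hκ : 0 ≤ κ) (hb : 0 ≤ b)
    (hA : 0 ≤ A) (hAb : b * A < 1) {f : Eucl d → ℝ} (hf : Measurable f) {g : Eucl d → ENNReal}
    (hg : ∫⁻ p, g p ∂gaussianWeight d < ⊤)
    (hfg : ∀ n : ℕ, ∀ p, ENNReal.ofReal (f (((2 : ℝ) ^ n)⁻¹ • p)) ≤ ENNReal.ofReal (A ^ n) * g p) :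
    ∫⁻ k, ENNReal.ofReal (f k) ∂multiscaleMeasure d κ b < ⊤ := by
  rw [lintegral_multiscaleMeasure hf.ennreal_ofReal]
  have h1 : ∀ n : ℕ, ENNReal.ofReal (κ * b ^ n) *
      ∫⁻ p, ENNReal.ofReal (f (((2 : ℝ) ^ n)⁻¹ • p)) ∂gaussianWeight d ≤
      ENNReal.ofReal (κ * (b * A) ^ n) * ∫⁻ p, g p ∂gaussianWeight d := by
    intro n
    calc _ ≤ ENNReal.ofReal (κ * b ^ n) *
          (ENNReal.ofReal (A ^ n) * ∫⁻ p, g p ∂gaussianWeight d) := by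
          gcongr
          rw [← lintegral_const_mul' _ _ ENNReal.ofReal_ne_top]
          exact lintegral_mono fun p => hfg n p
      _ = _ := by
          rw [← mul_assoc, ← ENNReal.ofReal_mul (by positivity), mul_pow, mul_assoc]
  refine (ENNReal.tsum_le_tsum h1).trans_lt ?_
  rw [ENNReal.tsum_mul_right]
  refine ENNReal.mul_lt_top ?_ hg
  have hs : Summable fun n : ℕ => κ * (b * A) ^ n :=
    (summable_geometric_of_lt_one (by positivity) hAb).mul_left κ
  rw [← ENNReal.ofReal_tsum_of_nonneg (fun n => by positivity) hs]
  exact ENNReal.ofReal_lt_top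

instance isFiniteMeasure_gaussianWeight (d : ℕ) : IsFiniteMeasure (gaussianWeight d) := by
  refine isFiniteMeasure_withDensity_ofReal ?_
  exact (integrable_exp_neg_mul_norm_sq (d := d) two_pos).hasFiniteIntegral

theorem isFiniteMeasure_multiscaleMeasure {d : ℕ} {κ b : ℝ} (hκ : 0 ≤ κ) (hb : 0 ≤ b)
    (hb1 : b < 1) : IsFiniteMeasure (multiscaleMeasure d κ b) := by
  constructor
  have h := lintegral_multiscaleMeasure_lt_top (d := d) (A := 1) (f := fun _ => 1) (g := fun _ => 1)
    hκ hb zero_le_one (by simpa using hb1) measurable_const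
    (by simp) (by simp)
  simpa using h

instance isNegInvariant_multiscaleMeasure (d : ℕ) (κ b : ℝ) :
    (multiscaleMeasure d κ b).IsNegInvariant := by
  refine ⟨Measure.ext_of_lintegral _ fun f hf => ?_⟩
  rw [Measure.neg, lintegral_map hf measurable_neg,
    lintegral_multiscaleMeasure (f := fun k => f (-k)) (hf.comp measurable_neg),
    lintegral_multiscaleMeasure hf]
  refine tsum_congr fun n => ?_
  congr 1
  rw [lintegral_gaussianWeight_ennreal (by fun_prop), lintegral_gaussianWeight_ennreal (by fun_prop)]
  rw [← lintegral_neg_eq_self]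
  simp only [norm_neg, smul_neg, neg_neg]

theorem integrable_exp_norm_sq_multiscaleMeasure {d : ℕ} {κ b : ℝ} (hκ : 0 ≤ κ) (hb : 0 ≤ b)
    (hb1 : b < 1) : Integrable (fun k => Real.exp (‖k‖ ^ 2)) (multiscaleMeasure d κ b) := by
  refine ⟨by fun_prop, ?_⟩
  rw [hasFiniteIntegral_iff_ofReal (Eventually.of_forall fun k => (Real.exp_pos _).le)]
  refine lintegral_multiscaleMeasure_lt_top (A := 1) hκ hb zero_le_one (by simpa using hb1)
    (by fun_prop) (g := fun p => ENNReal.ofReal (Real.exp (‖p‖ ^ 2))) ?_ ?_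
  · rw [lintegral_gaussianWeight (by fun_prop)]
    have h := (integrable_exp_neg_mul_norm_sq (d := d) one_pos).lintegral_lt_top
    refine lt_of_eq_of_lt (lintegral_congr fun p => ?_) h
    rw [← Real.exp_add]
    congr 2
    ring
  · intro n p
    rw [one_pow, ENNReal.ofReal_one, one_mul]
    refine ENNReal.ofReal_le_ofReal (Real.exp_le_exp.2 ?_)
    rw [norm_smul]
    refine pow_le_pow_left₀ (by positivity) (mul_le_of_le_one_left (norm_nonneg _) ?_) 2
    rw [Real.norm_of_nonneg (by positivity)]
    exact inv_le_one_of_one_le₀ (one_le_pow₀ one_le_two)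

theorem lintegral_norm_rpow_neg_multiscaleMeasure_lt_top {d : ℕ} (hd : 0 < d) {κ b ε : ℝ}
    (hκ : 0 ≤ κ) (hb : 0 ≤ b) (hε1 : ε < 1) (hbε : b * 2 ^ ε < 1) :
    ∫⁻ k, ENNReal.ofReal (‖k‖ ^ (-ε)) ∂multiscaleMeasure d κ b < ⊤ := by
  refine lintegral_multiscaleMeasure_lt_top (A := 2 ^ ε) hκ hb (by positivity) hbε
    (by fun_prop) (g := fun p => ENNReal.ofReal (‖p‖ ^ (-ε))) ?_ ?_
  · rw [lintegral_gaussianWeight (by fun_prop)]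
    have : Nontrivial (Eucl d) := by
      have : Nonempty (Fin d) := ⟨⟨0, hd⟩⟩
      infer_instance
    refine Integrable.lintegral_lt_top ?_
    refine (integrable_fun_norm_addHaar (volume : Measure (Eucl d))
      (f := fun y => Real.exp (-2 * y ^ 2) * y ^ (-ε))).2 ?_
    have hd1 : (1 : ℝ) ≤ d := by exact_mod_cast hd
    have h := integrableOn_rpow_mul_exp_neg_mul_sq (b := 2) two_pos (s := (d : ℝ) - 1 - ε)
      (by linarith)
    refine h.congr_fun (fun y hy => ?_) measurableSet_Ioi
    have hy : 0 < y := hy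
    simp only [finrank_euclideanSpace_fin, smul_eq_mul]
    rw [sub_eq_add_neg _ ε, Real.rpow_add hy, show (d : ℝ) - 1 = ((d - 1 : ℕ) : ℝ) by
      rw [Nat.cast_sub hd]; simp, Real.rpow_natCast]
    ring
  · intro n p
    rw [← ENNReal.ofReal_mul (by positivity), norm_smul, Real.norm_of_nonneg (by positivity),
      Real.mul_rpow (by positivity) (norm_nonneg _), Real.inv_rpow (by positivity),
      ← Real.rpow_neg (by positivity), neg_neg, ← Real.rpow_natCast, ← Real.rpow_natCast,
      ← Real.rpow_mul two_pos.le, ← Real.rpow_mul two_pos.le, mul_comm ε]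

theorem hasSum_integral_cos_multiscaleMeasure {d : ℕ} {κ b : ℝ} (hκ : 0 ≤ κ) (hb : 0 ≤ b)
    (hb1 : b < 1) (x : Eucl d) :
    HasSum (fun n : ℕ => κ * (Real.pi / 2) ^ ((d : ℝ) / 2) *
        (b ^ n * Real.exp (-(‖x‖ ^ 2 / (8 * 4 ^ n)))))
      (∫ k, Real.cos (inner ℝ k x) ∂multiscaleMeasure d κ b) := by
  have := isFiniteMeasure_multiscaleMeasure (d := d) hκ hb hb1
  have hint : Integrable (fun k => Real.cos (inner ℝ k x)) (multiscaleMeasure d κ b) :=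
    Integrable.of_bound (by fun_prop) 1 (Eventually.of_forall fun k => by
      simpa using Real.abs_cos_le_one _)
  have h := hasSum_integral_measure (f := fun k => Real.cos (inner ℝ k x))
    (μ := fun n : ℕ => ENNReal.ofReal (κ * b ^ n) •
      (gaussianWeight d).map fun p => ((2 : ℝ) ^ n)⁻¹ • p) hint
  refine h.congr_fun fun n => ?_
  rw [integral_smul_measure, ENNReal.toReal_ofReal (by positivity),
    integral_map (by fun_prop) (by fun_prop), gaussianWeight,
    integral_withDensity_eq_integral_toReal_smul (by fun_prop) (by simp)]
  have h1 : ∀ p : Eucl d, (ENNReal.ofReal (Real.exp (-2 * ‖p‖ ^ 2))).toReal •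
      Real.cos (inner ℝ (((2 : ℝ) ^ n)⁻¹ • p) x) =
      Real.cos (inner ℝ p (((2 : ℝ) ^ n)⁻¹ • x)) * Real.exp (-2 * ‖p‖ ^ 2) := fun p => by
    rw [ENNReal.toReal_ofReal (Real.exp_pos _).le, smul_eq_mul, mul_comm, real_inner_smul_left,
      real_inner_smul_right]
  simp only [h1]
  rw [integral_cos_mul_exp_neg_mul_norm_sq two_pos, norm_smul, Real.norm_of_nonneg (by positivity)]
  have h2 : ((((2 : ℝ) ^ n)⁻¹ * ‖x‖) ^ 2 / (4 * 2)) = ‖x‖ ^ 2 / (8 * 4 ^ n) := by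
    rw [mul_pow, inv_pow, ← pow_mul, mul_comm n, pow_mul]
    norm_num
    field_simp
  rw [h2, smul_eq_mul]
  ring

/-! ### Decay of the covariance and growth of the corrector -/

theorem two_rpow_neg_pow (β : ℝ) (n : ℕ) : ((2 : ℝ) ^ (-β)) ^ n = ((2 : ℝ) ^ n) ^ (-β) := by
  rw [← Real.rpow_natCast, ← Real.rpow_natCast, ← Real.rpow_mul two_pos.le,
    ← Real.rpow_mul two_pos.le, mul_comm]

theorem quarter_le_two_rpow_neg {β : ℝ} (hβ2 : β ≤ 2) : (4 : ℝ)⁻¹ ≤ 2 ^ (-β) := by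
  calc (4 : ℝ)⁻¹ = 2 ^ (-2 : ℝ) := by rw [Real.rpow_neg two_pos.le]; norm_num
    _ ≤ 2 ^ (-β) := Real.rpow_le_rpow_of_exponent_le one_le_two (by linarith)

theorem exp_neg_le_two_div_sq {u : ℝ} (hu : 0 < u) : Real.exp (-u) ≤ 2 / u ^ 2 := by
  have h := Real.pow_div_factorial_le_exp u hu.le 2
  norm_num [Nat.factorial] at h
  rw [Real.exp_neg, inv_eq_one_div, div_le_div_iff₀ (Real.exp_pos u) (by positivity)]
  linarith

/-- Geometric mixtures of Gaussians of dyadic widths decay like the power of `r` matching the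
geometric ratio: scales below `r` are cut off by the Gaussian, scales above form a convergent
geometric series. -/
theorem tsum_pow_mul_exp_neg_le {β : ℝ} (hβ : 0 < β) (hβ2 : β ≤ 2) {r : ℝ} (hr : 1 ≤ r) :
    ∑' n : ℕ, ((2 : ℝ) ^ (-β)) ^ n * Real.exp (-(r ^ 2 / (8 * 4 ^ n))) ≤
      4 * (128 + (1 - (2 : ℝ) ^ (-β))⁻¹) * r ^ (-β) := by
  set b : ℝ := 2 ^ (-β) with hb
  have hb0 : 0 < b := by positivity
  have hb4 : (4 : ℝ)⁻¹ ≤ b := quarter_le_two_rpow_neg hβ2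
  have hb1 : b < 1 := Real.rpow_lt_one_of_one_lt_of_neg one_lt_two (by linarith)
  obtain ⟨N, hN, hN'⟩ := exists_nat_pow_near hr one_lt_two
  have hgeo := summable_geometric_of_lt_one hb0.le hb1
  have hle : ∀ n : ℕ, b ^ n * Real.exp (-(r ^ 2 / (8 * 4 ^ n))) ≤ b ^ n := fun n =>
    mul_le_of_le_one_right (by positivity) (Real.exp_le_one_iff.2 (neg_nonpos.2 (by positivity)))
  have hs : Summable fun n : ℕ => b ^ n * Real.exp (-(r ^ 2 / (8 * 4 ^ n))) :=
    Summable.of_nonneg_of_le (fun n => by positivity) hle hgeo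
  have hbN : b ^ N ≤ 4 * r ^ (-β) := by
    have h1 : b ^ (N + 1) ≤ r ^ (-β) := by
      rw [hb, two_rpow_neg_pow]
      exact Real.rpow_le_rpow_of_nonpos (by linarith) hN'.le (by linarith)
    rw [pow_succ] at h1
    nlinarith [pow_pos hb0 N]
  have hlow : ∑ n ∈ Finset.range N, b ^ n * Real.exp (-(r ^ 2 / (8 * 4 ^ n))) ≤ 128 * b ^ N := by
    have hterm : ∀ n ∈ Finset.range N, b ^ n * Real.exp (-(r ^ 2 / (8 * 4 ^ n))) ≤
        128 * b ^ N * (4 ^ n / 4 ^ N) := by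
      intro n hn
      obtain ⟨k, rfl⟩ := Nat.exists_eq_add_of_lt (Finset.mem_range.1 hn)
      have hrN : (16 : ℝ) ^ (n + k + 1) ≤ r ^ 4 := by
        calc (16 : ℝ) ^ (n + k + 1) = (2 ^ (n + k + 1)) ^ 4 := by
              rw [← pow_mul, mul_comm, pow_mul]; norm_num
          _ ≤ r ^ 4 := pow_le_pow_left₀ (by positivity) hN 4
      have h1 : Real.exp (-(r ^ 2 / (8 * 4 ^ n))) ≤ 128 * (16 ^ (k + 1))⁻¹ := by
        refine (exp_neg_le_two_div_sq (by positivity)).trans ?_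
        have e : 2 / (r ^ 2 / (8 * 4 ^ n)) ^ 2 = 128 * 16 ^ n / r ^ 4 := by
          rw [show (16 : ℝ) ^ n = (4 ^ n) ^ 2 by rw [← pow_mul, mul_comm, pow_mul]; norm_num]
          field_simp
          norm_num
        rw [e, div_le_iff₀ (by positivity), mul_assoc]
        refine mul_le_mul_of_nonneg_left ?_ (by norm_num)
        rw [← div_eq_inv_mul, le_div_iff₀ (by positivity), ← pow_add]
        exact hrN
      have h2 : (4 ^ (k + 1) : ℝ)⁻¹ ≤ b ^ (k + 1) := by
        rw [← inv_pow]
        exact pow_le_pow_left₀ (by norm_num) hb4 _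
      have h3 : (4 : ℝ) ^ n / 4 ^ (n + k + 1) = (4 ^ (k + 1))⁻¹ := by
        rw [add_assoc, pow_add 4 n]
        field_simp
      have h4 : (16 ^ (k + 1) : ℝ)⁻¹ = (4 ^ (k + 1))⁻¹ * (4 ^ (k + 1))⁻¹ := by
        rw [← mul_inv, ← mul_pow]; norm_num
      rw [h3]
      calc b ^ n * Real.exp (-(r ^ 2 / (8 * 4 ^ n)))
          ≤ b ^ n * (128 * (16 ^ (k + 1))⁻¹) := mul_le_mul_of_nonneg_left h1 (by positivity)
        _ = 128 * b ^ n * (4 ^ (k + 1))⁻¹ * (4 ^ (k + 1))⁻¹ := by rw [h4]; ring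
        _ ≤ 128 * b ^ n * b ^ (k + 1) * (4 ^ (k + 1))⁻¹ := by gcongr
        _ = _ := by rw [add_assoc, pow_add b n]; ring
    refine (Finset.sum_le_sum hterm).trans ?_
    rw [← Finset.mul_sum, ← Finset.sum_div]
    refine mul_le_of_le_one_right (by positivity) ?_
    rw [div_le_one (by positivity), geom_sum_eq (by norm_num)]
    rw [div_le_iff₀ (by norm_num)]
    nlinarith [pow_pos (four_pos : (0 : ℝ) < 4) N]
  have hhigh : ∑' n : ℕ, b ^ (n + N) * Real.exp (-(r ^ 2 / (8 * 4 ^ (n + N)))) ≤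
      b ^ N * (1 - b)⁻¹ := by
    rw [← tsum_geometric_of_lt_one hb0.le hb1, ← tsum_mul_left]
    refine Summable.tsum_le_tsum (fun n => ?_) ((summable_nat_add_iff N).2 hs) (hgeo.mul_left _)
    exact (hle (n + N)).trans (by rw [pow_add, mul_comm])
  rw [← hs.sum_add_tsum_nat_add N]
  have hinv : 0 < (1 - b)⁻¹ := inv_pos.2 (by linarith)
  calc _ ≤ 128 * b ^ N + b ^ N * (1 - b)⁻¹ := add_le_add hlow hhigh
    _ = (128 + (1 - b)⁻¹) * b ^ N := by ring
    _ ≤ (128 + (1 - b)⁻¹) * (4 * r ^ (-β)) := mul_le_mul_of_nonneg_left hbN (by positivity)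
    _ = _ := by ring

theorem incrementDensity_smul {d : ℕ} (e x p : Eucl d) {c : ℝ} (hc : c ≠ 0) :
    incrementDensity e x (c • p) = (c ^ 2)⁻¹ * incrementDensity e (c • x) p := by
  simp only [incrementDensity, correctorSymbol, norm_smul, real_inner_smul_left,
    real_inner_smul_right, mul_pow, Real.norm_eq_abs, sq_abs]
  have h : c * inner ℝ e p / (c ^ 2 * ‖p‖ ^ 2) = c⁻¹ * (inner ℝ e p / ‖p‖ ^ 2) := by
    rw [mul_div_mul_comm]
    congr 1
    field_simp
  rw [h, mul_pow, inv_pow, mul_assoc]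

/-- The second moment of the corrector increment over distance `‖x‖ ≥ 2^N` collects all pairs
`(n, m)` with `n + m ≤ N`: the `n`-th component of the spectral measure and the frequencies
`2^{-m}` relative to it. -/
theorem sum_le_lintegral_incrementDensity_multiscaleMeasure {d : ℕ} {κ b : ℝ} (hκ : 0 ≤ κ)
    (hb : 0 ≤ b) {e x : Eucl d} (he : ‖e‖ = 1) {N : ℕ} (hx : 2 ^ N ≤ ‖x‖) :
    ENNReal.ofReal (κ / 1728 * ∑ n ∈ Finset.range (N + 1), (4 * b) ^ n *
        ∑ m ∈ Finset.range (N + 1 - n), (4 / 2 ^ d : ℝ) ^ m) ≤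
      ∫⁻ k, ENNReal.ofReal (incrementDensity e x k) ∂multiscaleMeasure d κ b := by
  have hmeas : Measurable fun p => incrementDensity e x p :=
    Measurable.of_uncurry_left (f := incrementDensity e) (measurable_incrementDensity e)
  rw [lintegral_multiscaleMeasure hmeas.ennreal_ofReal]
  refine le_trans ?_ (ENNReal.sum_le_tsum (Finset.range (N + 1)))
  rw [Finset.mul_sum, ENNReal.ofReal_sum_of_nonneg fun n _ => by positivity]
  refine Finset.sum_le_sum fun n hn => ?_
  have hnN : n ≤ N := Nat.lt_succ_iff.1 (Finset.mem_range.1 hn)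
  have hF := sum_le_lintegral_incrementDensity_gaussianWeight (d := d)
    (x := ((2 : ℝ) ^ n)⁻¹ • x) he (M := N + 1 - n) (fun m hm => by
      rw [norm_smul, Real.norm_of_nonneg (by positivity), ← div_eq_inv_mul,
        le_div_iff₀ (by positivity), ← pow_add]
      exact (pow_le_pow_right₀ one_le_two (by omega)).trans hx)
  have hscale : ∀ p, ENNReal.ofReal (incrementDensity e x (((2 : ℝ) ^ n)⁻¹ • p)) =
      ENNReal.ofReal (4 ^ n) * ENNReal.ofReal (incrementDensity e (((2 : ℝ) ^ n)⁻¹ • x) p) := by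
    intro p
    rw [← ENNReal.ofReal_mul (by positivity), incrementDensity_smul _ _ _ (by positivity),
      inv_pow, inv_inv, ← pow_mul, mul_comm n, pow_mul]
    norm_num
  simp only [hscale]
  rw [lintegral_const_mul' _ _ ENNReal.ofReal_ne_top, ← mul_assoc (ENNReal.ofReal _),
    ← ENNReal.ofReal_mul (by positivity)]
  refine le_trans (le_of_eq ?_) (mul_le_mul_right hF _)
  rw [← ENNReal.ofReal_mul (by positivity), mul_pow]
  congr 1
  ring

theorem rpow_le_sum_scales {β : ℝ} (hβ : 0 < β) (hβ2 : β ≤ 2) (d : ℕ) {r : ℝ} {N : ℕ}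
    (hr : 0 ≤ r) (hN : r < 2 ^ (N + 1)) :
    4⁻¹ * r ^ (2 - β) ≤ ∑ n ∈ Finset.range (N + 1), (4 * (2 : ℝ) ^ (-β)) ^ n *
        ∑ m ∈ Finset.range (N + 1 - n), (4 / 2 ^ d : ℝ) ^ m := by
  have h1 : (4 * (2 : ℝ) ^ (-β)) ^ N * ∑ m ∈ Finset.range (N + 1 - N), (4 / 2 ^ d : ℝ) ^ m ≤ _ :=
    Finset.single_le_sum (f := fun n => (4 * (2 : ℝ) ^ (-β)) ^ n *
      ∑ m ∈ Finset.range (N + 1 - n), (4 / 2 ^ d : ℝ) ^ m) (fun n _ => by positivity)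
      (Finset.self_mem_range_succ N)
  refine le_trans ?_ h1
  have h2 : 4 * (2 : ℝ) ^ (-β) = 2 ^ (2 - β) := by
    rw [sub_eq_add_neg, Real.rpow_add two_pos]; norm_num
  have h3 : ((2 : ℝ) ^ (2 - β)) ^ N = (2 ^ N) ^ (2 - β) := by
    have := two_rpow_neg_pow (-(2 - β)) N
    rwa [neg_neg] at this
  rw [h2, h3, Nat.add_sub_cancel_left, Finset.sum_range_one, pow_zero, mul_one]
  have h4 : r ^ (2 - β) ≤ (2 ^ N * 2) ^ (2 - β) := by
    rw [← pow_succ]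
    exact Real.rpow_le_rpow hr hN.le (by linarith)
  rw [Real.mul_rpow (by positivity) two_pos.le] at h4
  have h5 : (2 : ℝ) ^ (2 - β) ≤ 4 := by
    calc (2 : ℝ) ^ (2 - β) ≤ 2 ^ (2 : ℝ) :=
          Real.rpow_le_rpow_of_exponent_le one_le_two (by linarith)
      _ = 4 := by norm_num
  have h6 : (0 : ℝ) ≤ (2 ^ N) ^ (2 - β) := by positivity
  nlinarith

theorem log_le_of_lt_two_pow {r : ℝ} {N : ℕ} (hr : 0 < r) (hN : r < 2 ^ (N + 1)) :
    Real.log r ≤ N + 1 := by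
  have h := Real.log_le_log hr hN.le
  rw [Real.log_pow] at h
  push_cast at h
  nlinarith [Real.log_two_lt_d9, Nat.cast_nonneg (α := ℝ) N]

theorem log_le_sum_scales (d : ℕ) {r : ℝ} {N : ℕ} (hr : 0 < r) (hN : r < 2 ^ (N + 1)) :
    Real.log r ≤ ∑ n ∈ Finset.range (N + 1), (4 * (2 : ℝ) ^ (-2 : ℝ)) ^ n *
        ∑ m ∈ Finset.range (N + 1 - n), (4 / 2 ^ d : ℝ) ^ m := by
  have h1 : 4 * (2 : ℝ) ^ (-2 : ℝ) = 1 := by rw [Real.rpow_neg two_pos.le]; norm_num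
  calc Real.log r ≤ ∑ n ∈ Finset.range (N + 1), (1 : ℝ) := by
        simpa using log_le_of_lt_two_pow hr hN
    _ ≤ _ := Finset.sum_le_sum fun n hn => by
        rw [h1, one_pow, one_mul]
        have := Finset.mem_range.1 hn
        exact (pow_zero (4 / 2 ^ d : ℝ)).symm.le.trans
          (Finset.single_le_sum (f := fun m => (4 / 2 ^ d : ℝ) ^ m) (fun m _ => by positivity)
            (Finset.mem_range.2 (by omega)))

theorem half_log_sq_le_sum_scales {r : ℝ} {N : ℕ} (hr : 1 ≤ r) (hN : r < 2 ^ (N + 1)) :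
    2⁻¹ * Real.log r ^ 2 ≤ ∑ n ∈ Finset.range (N + 1), (4 * (2 : ℝ) ^ (-2 : ℝ)) ^ n *
        ∑ m ∈ Finset.range (N + 1 - n), (4 / 2 ^ 2 : ℝ) ^ m := by
  have h1 : 4 * (2 : ℝ) ^ (-2 : ℝ) = 1 := by rw [Real.rpow_neg two_pos.le]; norm_num
  have h2 : ∑ n ∈ Finset.range (N + 1), (4 * (2 : ℝ) ^ (-2 : ℝ)) ^ n *
      ∑ m ∈ Finset.range (N + 1 - n), (4 / 2 ^ 2 : ℝ) ^ m =
      ∑ n ∈ Finset.range (N + 1), ((n + 1 : ℕ) : ℝ) := by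
    rw [← Finset.sum_range_reflect (fun n => ((n + 1 : ℕ) : ℝ))]
    refine Finset.sum_congr rfl fun n hn => ?_
    have := Finset.mem_range.1 hn
    rw [h1, show (4 / 2 ^ 2 : ℝ) = 1 by norm_num]
    simp only [one_pow, one_mul, Finset.sum_const, Finset.card_range, nsmul_eq_mul, mul_one]
    congr 1
    omega
  have h3 : ∀ K : ℕ, ∑ n ∈ Finset.range K, ((n + 1 : ℕ) : ℝ) = K * (K + 1) / 2 := by
    intro K
    induction K with
    | zero => simp
    | succ K ih => rw [Finset.sum_range_succ, ih]; push_cast; ring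
  have h4 := pow_le_pow_left₀ (Real.log_nonneg hr)
    (log_le_of_lt_two_pow (zero_lt_one.trans_le hr) hN) 2
  rw [h2, h3]
  push_cast
  nlinarith [Nat.cast_nonneg (α := ℝ) N]

/-! ### Uniqueness of corrector increments and the lower bound -/

theorem SublinearGrowth.sub {d : ℕ} {u v : Eucl d → ℝ} (hu : Continuous u) (hv : Continuous v)
    (hus : SublinearGrowth u) (hvs : SublinearGrowth v) : SublinearGrowth fun x => u x - v x := by
  have hlim := (hus.const_mul 2).add (hvs.const_mul 2)
  rw [mul_zero, add_zero] at hlim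
  refine squeeze_zero (fun R => ?_) (fun R => ?_) hlim
  · rw [setAverage_eq, smul_eq_mul]
    exact mul_nonneg (by positivity) (integral_nonneg fun x => by positivity)
  · have hint : ∀ f : Eucl d → ℝ, Continuous f →
        IntegrableOn (fun x => |f x| ^ 2 / R ^ 2) (Metric.ball 0 R) := fun f hf =>
      ((((hf.abs.pow 2).div_const _).locallyIntegrable.integrableOn_isCompact
        (isCompact_closedBall (0 : Eucl d) R))).mono_set Metric.ball_subset_closedBall
    have hmono := integral_mono (hint _ (hu.sub hv))
      (((hint u hu).const_mul 2).add ((hint v hv).const_mul 2)) (fun x => by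
        simp only [Pi.add_apply, Pi.sub_apply, sq_abs]
        rw [← mul_div_assoc, ← mul_div_assoc, ← add_div]
        exact div_le_div_of_nonneg_right (by nlinarith [sq_nonneg (u x + v x)]) (by positivity))
    have hadd := integral_add ((hint u hu).const_mul 2) ((hint v hv).const_mul 2)
    simp only [Pi.add_apply, integral_const_mul] at hmono hadd
    rw [hadd] at hmono
    simp only [setAverage_eq, smul_eq_mul]
    calc _ ≤ (volume.real (Metric.ball (0 : Eucl d) R))⁻¹ * _ :=
          mul_le_mul_of_nonneg_left hmono (by positivity)
      _ = _ := by ring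

/-- Two linearized correctors of the same field have the same increments: their difference is
weakly harmonic with sublinear growth, hence constant. -/
theorem ae_sub_eq_sub_of_isLinearizedCorrector {d : ℕ} (hd : 0 < d) {Ω : Type*} [MeasurableSpace Ω]
    {P : Measure Ω} {e : Eucl d} {w φ ψ : Ω → Eucl d → ℝ} (hφ : IsLinearizedCorrector P e w φ)
    (hψ : IsLinearizedCorrector P e w ψ) :
    ∀ᵐ s ∂P, ∀ x, φ s x - φ s 0 = ψ s x - ψ s 0 := by
  filter_upwards [hφ.continuous, hφ.solves, hφ.sublinear, hψ.continuous, hψ.solves, hψ.sublinear]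
    with s c1 e1 g1 c2 e2 g2 x
  have hint : ∀ (u ζ : Eucl d → ℝ), Continuous u → ContDiff ℝ (⊤ : ℕ∞) ζ → HasCompactSupport ζ →
      Integrable fun y => u y * Laplacian.laplacian ζ y := fun u ζ hu hζ hζc =>
    (hu.mul (continuous_laplacian_of_contDiff hζ)).integrable_of_hasCompactSupport
      (hasCompactSupport_laplacian hζc).mul_left
  have h := eq_of_weakly_harmonic_of_sublinearGrowth hd (c1.sub c2) (fun ζ hζ hζc => by
    simp only [Pi.sub_apply, sub_mul]
    rw [integral_sub (hint _ ζ c1 hζ hζc) (hint _ ζ c2 hζ hζc), e1 ζ hζ hζc, e2 ζ hζ hζc, sub_self])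
    (g1.sub c1 c2 g2) x
  simp only [Pi.sub_apply] at h
  linarith

theorem le_laverage_annulus {d : ℕ} (hd : 0 < d) {R : ℝ} (hR : 0 < R) {f : Eucl d → ENNReal}
    {c : ENNReal} (hf : ∀ x, R < ‖x‖ → c ≤ f x) :
    c ≤ ⨍⁻ x, f x ∂(volume.restrict {x : Eucl d | R < ‖x‖ ∧ ‖x‖ < 2 * R}) := by
  have hopen : IsOpen {x : Eucl d | R < ‖x‖ ∧ ‖x‖ < 2 * R} :=
    (isOpen_lt continuous_const continuous_norm).inter (isOpen_lt continuous_norm continuous_const)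
  have hne : {x : Eucl d | R < ‖x‖ ∧ ‖x‖ < 2 * R}.Nonempty := by
    refine ⟨EuclideanSpace.single ⟨0, hd⟩ (3 / 2 * R), ?_⟩
    rw [Set.mem_ofPred_eq, PiLp.norm_single, Real.norm_of_nonneg (by positivity)]
    constructor <;> linarith
  have h0 := (hopen.measure_pos volume hne).ne'
  have htop : volume {x : Eucl d | R < ‖x‖ ∧ ‖x‖ < 2 * R} ≠ ⊤ :=
    ((measure_mono fun x hx => mem_ball_zero_iff.2 hx.2).trans_lt
      (measure_ball_lt_top (x := (0 : Eucl d)) (r := 2 * R))).ne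
  rw [setLAverage_eq, ENNReal.le_div_iff_mul_le (Or.inl h0) (Or.inl htop), ← setLIntegral_const]
  exact setLIntegral_mono' hopen.measurableSet fun x hx => hf x hx.1

/-- A centered stationary Gaussian field with covariance bounded by `‖x‖^{-β}` together with a
corrector `ψ` vanishing at the origin, whose second moments are bounded below by the dyadic double
sums of `sum_le_lintegral_incrementDensity_multiscaleMeasure`. -/
theorem exists_field_corrector_with_large_increments {d : ℕ} (hd : 0 < d) {e : Eucl d}
    (he : ‖e‖ = 1) {β : ℝ} (hβ : 0 < β) (hβ2 : β ≤ 2) :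
    ∃ (Ω : Type) (_ : MeasurableSpace Ω) (P : Measure Ω) (w ψ : Ω → Eucl d → ℝ) (c : ℝ),
      IsProbabilityMeasure P ∧ IsCenteredStationaryGaussianField P w ∧
      (∀ x : Eucl d, 1 ≤ ‖x‖ → |covFun P w x| ≤ ‖x‖ ^ (-β)) ∧
      IsLinearizedCorrector P e w ψ ∧ (∀ᵐ s ∂P, ψ s 0 = 0) ∧ 0 < c ∧
      ∀ (x : Eucl d) (N : ℕ), 2 ^ N ≤ ‖x‖ →
        ENNReal.ofReal (c * ∑ n ∈ Finset.range (N + 1), (4 * (2 : ℝ) ^ (-β)) ^ n *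
          ∑ m ∈ Finset.range (N + 1 - n), (4 / 2 ^ d : ℝ) ^ m) ≤
          ∫⁻ s, ENNReal.ofReal (ψ s x ^ 2) ∂P := by
  set b : ℝ := 2 ^ (-β) with hb
  have hb0 : 0 < b := by positivity
  have hb1 : b < 1 := Real.rpow_lt_one_of_one_lt_of_neg one_lt_two (by linarith)
  have hC : 0 < (Real.pi / 2) ^ ((d : ℝ) / 2) * (4 * (128 + (1 - b)⁻¹)) := by
    have : 0 < (1 - b)⁻¹ := inv_pos.2 (by linarith)
    positivity
  -- the amplitude normalizes the covariance bound to have constant one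
  obtain ⟨κ, hκ, hκC⟩ : ∃ κ : ℝ, 0 < κ ∧
      κ * ((Real.pi / 2) ^ ((d : ℝ) / 2) * (4 * (128 + (1 - b)⁻¹))) = 1 :=
    ⟨_, inv_pos.2 hC, inv_mul_cancel₀ hC.ne'⟩
  set μ := multiscaleMeasure d κ b with hμ
  have : IsFiniteMeasure μ := isFiniteMeasure_multiscaleMeasure hκ.le hb0.le hb1
  have hneg : μ.IsNegInvariant := isNegInvariant_multiscaleMeasure d κ b
  obtain ⟨Ω, mΩ, P, w, ψ, hP, hw, hcov, hψm, hψc, hψe, hψ2⟩ :=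
    exists_gaussianField_of_spectralMeasure he μ
      (integrable_exp_norm_sq_multiscaleMeasure hκ.le hb0.le hb1)
  refine ⟨Ω, mΩ, P, w, ψ, κ / 1728, hP, hw, fun x hx => ?_, ?_, ?_, by positivity, fun x N hx => ?_⟩
  · have h := hasSum_integral_cos_multiscaleMeasure (d := d) hκ.le hb0.le hb1 x
    have hdecay := tsum_pow_mul_exp_neg_le hβ hβ2 hx
    rw [hcov, ← h.tsum_eq, tsum_mul_left, abs_of_nonneg
      (mul_nonneg (by positivity) (tsum_nonneg fun n => by positivity))]
    calc κ * (Real.pi / 2) ^ ((d : ℝ) / 2) * _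
        ≤ κ * (Real.pi / 2) ^ ((d : ℝ) / 2) * (4 * (128 + (1 - b)⁻¹) * ‖x‖ ^ (-β)) :=
          mul_le_mul_of_nonneg_left hdecay (by positivity)
      _ = κ * ((Real.pi / 2) ^ ((d : ℝ) / 2) * (4 * (128 + (1 - b)⁻¹))) * ‖x‖ ^ (-β) := by ring
      _ = ‖x‖ ^ (-β) := by rw [hκC, one_mul]
  · refine ⟨fun x => (hψm x).aemeasurable, Eventually.of_forall hψc, hψe, ?_⟩
    -- an exponent below `β` leaves a finite negative moment of the spectral measure, and an
    -- exponent below `1` keeps that moment finite in dimension one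
    obtain ⟨ε, hε, hε1, hεβ⟩ : ∃ ε : ℝ, 0 < ε ∧ ε < 1 ∧ ε < β :=
      ⟨min 1 β / 2, by positivity, by linarith [min_le_left 1 β],
        by linarith [min_le_right 1 β]⟩
    have hbε : b * 2 ^ ε < 1 := by
      rw [hb, ← Real.rpow_add two_pos]
      exact Real.rpow_lt_one_of_one_lt_of_neg one_lt_two (by linarith)
    have hfin := lintegral_norm_rpow_neg_multiscaleMeasure_lt_top hd hκ.le hb0.le hε1 hbε
    refine ae_sublinearGrowth_of_lintegral_sq_le hψm hψc
      (A := 4 * (∫⁻ k, ENNReal.ofReal (‖k‖ ^ (-ε)) ∂μ).toReal) hε (by linarith) (by positivity)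
      fun x => ?_
    rw [hψ2]
    calc ∫⁻ k, ENNReal.ofReal (incrementDensity e x k) ∂μ
        ≤ ∫⁻ k, ENNReal.ofReal (4 * ‖x‖ ^ (2 - ε)) * ENNReal.ofReal (‖k‖ ^ (-ε)) ∂μ :=
          lintegral_mono fun k => by
            rw [← ENNReal.ofReal_mul (by positivity)]
            exact ENNReal.ofReal_le_ofReal (incrementDensity_le he hε.le (by linarith) x k)
      _ = ENNReal.ofReal (4 * ‖x‖ ^ (2 - ε)) *
          ENNReal.ofReal (∫⁻ k, ENNReal.ofReal (‖k‖ ^ (-ε)) ∂μ).toReal := by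
          rw [lintegral_const_mul' _ _ ENNReal.ofReal_ne_top, ENNReal.ofReal_toReal hfin.ne]
      _ = _ := by
          rw [← ENNReal.ofReal_mul (by positivity)]
          congr 1
          ring
  · have h0 := hψ2 0
    simp only [incrementDensity, inner_zero_right, Real.cos_zero, sub_self, mul_zero,
      ENNReal.ofReal_zero, lintegral_zero] at h0
    rw [lintegral_eq_zero_iff ((hψm 0).pow_const 2).ennreal_ofReal] at h0
    filter_upwards [h0] with s hs
    have h1 := ENNReal.ofReal_eq_zero.1 hs
    exact pow_eq_zero_iff two_ne_zero |>.1 (le_antisymm h1 (sq_nonneg _))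
  · rw [hψ2]
    exact sum_le_lintegral_incrementDensity_multiscaleMeasure hκ.le hb0.le he hx

theorem mainTheorem10 (d : ℕ) (hd : 0 < d) (β : ℝ) (hβ : 0 < β) (hβ2 : β ≤ 2) :
    ∃ (Ω : Type) (_ : MeasurableSpace Ω) (P : Measure Ω) (w : Ω → Eucl d → ℝ),
      IsProbabilityMeasure P ∧
      IsCenteredStationaryGaussianField P w ∧
      (∀ x : Eucl d, 1 ≤ ‖x‖ → |covFun P w x| ≤ ‖x‖ ^ (-β)) ∧
      (∃ φ : Ω → Eucl d → ℝ,
        IsLinearizedCorrector P (EuclideanSpace.single ⟨0, hd⟩ 1) w φ) ∧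
      ∃ C : ℝ, 0 < C ∧ ∃ R₀ : ℝ, 1 ≤ R₀ ∧
        ∀ φ : Ω → Eucl d → ℝ,
          IsLinearizedCorrector P (EuclideanSpace.single ⟨0, hd⟩ 1) w φ →
          ∀ R : ℝ, R₀ ≤ R →
            (β < 2 → ENNReal.ofReal (C * R ^ (2 - β)) ≤ annularMeanSquare P φ R) ∧
            (β = 2 → d = 2 → ENNReal.ofReal (C * Real.log R ^ 2) ≤ annularMeanSquare P φ R) ∧
            (β = 2 → 2 < d → ENNReal.ofReal (C * Real.log R) ≤ annularMeanSquare P φ R) := by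
  have he : ‖(EuclideanSpace.single ⟨0, hd⟩ 1 : Eucl d)‖ = 1 := by
    rw [PiLp.norm_single, norm_one]
  obtain ⟨Ω, mΩ, P, w, ψ, c, hP, hw, hcov, hψ, hψ0, hc, hlow⟩ :=
    exists_field_corrector_with_large_increments hd he hβ hβ2
  refine ⟨Ω, mΩ, P, w, hP, hw, hcov, ⟨ψ, hψ⟩, c / 4, by positivity, 1, le_rfl,
    fun φ hφ R hR => ?_⟩
  have hincr : ∀ x, ∫⁻ s, ENNReal.ofReal (|φ s x - φ s 0| ^ 2) ∂P =
      ∫⁻ s, ENNReal.ofReal (ψ s x ^ 2) ∂P := fun x => by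
    refine lintegral_congr_ae ?_
    filter_upwards [ae_sub_eq_sub_of_isLinearizedCorrector hd hφ hψ, hψ0] with s hs h0
    rw [hs x, h0, sub_zero, sq_abs]
  -- it remains to bound the dyadic double sum below at every point of the annulus
  have key : ∀ t : ℝ, (∀ (r : ℝ) (N : ℕ), R < r → r < 2 ^ (N + 1) →
      4⁻¹ * t ≤ ∑ n ∈ Finset.range (N + 1), (4 * (2 : ℝ) ^ (-β)) ^ n *
        ∑ m ∈ Finset.range (N + 1 - n), (4 / 2 ^ d : ℝ) ^ m) →
      ENNReal.ofReal (c / 4 * t) ≤ annularMeanSquare P φ R := by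
    intro t ht
    refine le_laverage_annulus hd (by linarith) fun x hx => ?_
    obtain ⟨N, hN, hN'⟩ := exists_nat_pow_near (hR.trans hx.le) one_lt_two
    rw [hincr]
    refine le_trans (ENNReal.ofReal_le_ofReal ?_) (hlow x N hN)
    rw [div_eq_mul_inv, mul_assoc]
    exact mul_le_mul_of_nonneg_left (ht ‖x‖ N hx hN') hc.le
  have hR0 : 0 < R := by linarith
  refine ⟨fun _ => key _ fun r N hr hN => ?_, ?_, ?_⟩
  · refine le_trans ?_ (rpow_le_sum_scales hβ hβ2 d (hR0.trans hr).le hN)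
    exact mul_le_mul_of_nonneg_left (Real.rpow_le_rpow hR0.le hr.le (by linarith)) (by norm_num)
  · rintro rfl rfl
    refine key _ fun r N hr hN => ?_
    have h1 := half_log_sq_le_sum_scales (hR.trans hr.le) hN
    have h2 := pow_le_pow_left₀ (Real.log_nonneg hR) (Real.log_le_log hR0 hr.le) 2
    nlinarith [sq_nonneg (Real.log R)]
  · rintro rfl -
    refine key _ fun r N hr hN => ?_
    have h1 := log_le_sum_scales d (hR0.trans hr) hN
    have h2 := Real.log_le_log hR0 hr.le
    linarith [Real.log_nonneg hR]
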